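/- Let $k$ be an algebraically closed field of characteristic $0$, let $n \ge 1$ and $d \ge 2$, and put $N = (n+1)\binom{n+d}{d} - 1$. Let $\overline{\mathrm{End}}{}^n_d \cong \mathbb{P}^N$ be the projective space of $(n+1)$-tuples $f = (f_0 : \dots : f_n)$ of homogeneous forms of degree $d$ in $x_0, \dots, x_n$ over $k$, not all zero and up to a common nonzero scalar, with the coefficients $f_{i,\alpha}$ ($0 \le i \le n$, $|\alpha| = d$) as homogeneous coordinates. Let $\mathrm{End}^n_d \subset \overline{\mathrm{End}}{}^n_d$ be the subset of those $f$ that are morphisms $\mathbb{P}^n \to \mathbb{P}^n$ of degree $d$, i.e. whose forms $f_0, \dots, f_n$ have no common zero in $\mathbb{P}^n$. Let $J = \det(\partial f_i / \partial x_j)_{0 \le i,j \le n}$ be the Jacobian determinant, viewed as a bihomogeneous polynomial in the $f_{i,\alpha}$ and the $x_j$, and let $$V(J) = \{(f, P) \in \mathrm{End}^n_d \times \mathbb{P}^n : J(f, P) = 0\}$$ be the space of degree-$d$ endomorphisms of $\mathbb{P}^n$ with a marked critical point. Here $\mathrm{End}^n_d$ and $\mathrm{End}^n_d \times \mathbb{P}^n$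 carry the Zariski topologies induced from $\mathbb{P}^N$ and $\mathbb{P}^N \times \mathbb{P}^n$. Then $\dim \mathrm{End}^n_d = N$, and $V(J)$ is an irreducible hypersurface in $\mathrm{End}^n_d \times \mathbb{P}^n$, that is, an irreducible closed subset of pure codimension $1$; its dimension is $\dim V(J) = n + N - 1$. -/

import Mathlib

namespace MarkedCrit

noncomputable section

/-! ### Zariski topology on a projective space and on a product of two projective spaces

All varieties are sets of closed points over the ground field `k`. -/

section Zariski

variable (k : Type*) [Field k] (σ τ : Type*)

/-- The projective space of lines in `k ^ σ`, with homogeneous coordinates indexed by `σ`. -/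
structure Proj where
  pt : Projectivization k (σ → k)

/-- The product `ℙ(k ^ σ) × ℙ(k ^ τ)`. It is a type of its own since its Zariski topology is not
the product topology. -/
structure BiProj where
  fst : Proj k σ
  snd : Proj k τ

variable {k σ τ}

/-- A chosen vector of homogeneous coordinates (never zero). -/
def Proj.coord (p : Proj k σ) : σ → k := p.pt.rep

/-- The zero locus in `ℙ(k ^ σ)` of a (homogeneous) polynomial. -/
def Proj.zeros (F : MvPolynomial σ k) : Set (Proj k σ) :=
  {p | MvPolynomial.eval p.coord F = 0}

/-- `F` is bihomogeneous of bidegree `(a, b)`: of degree `a` in the variables indexed by `σ` and of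
degree `b` in the variables indexed by `τ`. -/
def IsBihomogeneous (F : MvPolynomial (σ ⊕ τ) k) (a b : ℕ) : Prop :=
  MvPolynomial.IsWeightedHomogeneous
    (Sum.elim (fun _ => (1, 0)) (fun _ => (0, 1)) : σ ⊕ τ → ℕ × ℕ) F (a, b)

/-- The zero locus in `ℙ(k ^ σ) × ℙ(k ^ τ)` of a (bihomogeneous) polynomial. -/
def BiProj.zeros (F : MvPolynomial (σ ⊕ τ) k) : Set (BiProj k σ τ) :=
  {x | MvPolynomial.eval (Sum.elim x.fst.coord x.snd.coord) F = 0}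

/-- The Zariski topology on `ℙ(k ^ σ)`: the complements of the zero loci of homogeneous polynomials
are a base of open sets. -/
instance : TopologicalSpace (Proj k σ) :=
  TopologicalSpace.generateFrom
    {U | ∃ (F : MvPolynomial σ k) (a : ℕ), F.IsHomogeneous a ∧ U = (Proj.zeros F)ᶜ}

/-- The Zariski topology on `ℙ(k ^ σ) × ℙ(k ^ τ)`: the complements of the zero loci of bihomogeneous
polynomials are a base of open sets. -/
instance : TopologicalSpace (BiProj k σ τ) :=
  TopologicalSpace.generateFrom
    {U | ∃ (F : MvPolynomial (σ ⊕ τ) k) (a b : ℕ), IsBihomogeneous F a b ∧ U = (BiProj.zeros F)ᶜ}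

/-- Vanishing of a homogeneous polynomial at a point does not depend on the homogeneous
coordinates. -/
theorem Proj.mem_zeros_iff {F : MvPolynomial σ k} {a : ℕ} (hF : F.IsHomogeneous a)
    (v : σ → k) (hv : v ≠ 0) :
    (⟨Projectivization.mk k v hv⟩ : Proj k σ) ∈ Proj.zeros F ↔ MvPolynomial.eval v F = 0 := by
  obtain ⟨u, hu⟩ := Projectivization.exists_smul_eq_mk_rep k v hv
  have h : Proj.coord ⟨Projectivization.mk k v hv⟩ = (u : k) • v := hu.symm
  have key : MvPolynomial.eval ((u : k) • v) F = (u : k) ^ a * MvPolynomial.eval v F := by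
    rw [MvPolynomial.eval_eq, MvPolynomial.eval_eq, Finset.mul_sum]
    refine Finset.sum_congr rfl fun m hm => ?_
    have hdeg : m.degree = a := by
      rw [Finsupp.degree_eq_weight_one]
      exact hF (MvPolynomial.mem_support_iff.1 hm)
    simp only [Pi.smul_apply, smul_eq_mul, mul_pow, Finset.prod_mul_distrib,
      Finset.prod_pow_eq_pow_sum]
    rw [← hdeg, Finsupp.degree_apply]
    ring
  simp [Proj.zeros, h, key]

/-- Vanishing of a bihomogeneous polynomial at a point does not depend on the homogeneous
coordinates. -/
theorem BiProj.mem_zeros_iff {F : MvPolynomial (σ ⊕ τ) k} {a b : ℕ} (hF : IsBihomogeneous F a b)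
    (v : σ → k) (hv : v ≠ 0) (w : τ → k) (hw : w ≠ 0) :
    (⟨⟨Projectivization.mk k v hv⟩, ⟨Projectivization.mk k w hw⟩⟩ : BiProj k σ τ) ∈ BiProj.zeros F ↔
      MvPolynomial.eval (Sum.elim v w) F = 0 := by
  obtain ⟨s, hs⟩ := Projectivization.exists_smul_eq_mk_rep k v hv
  obtain ⟨t, ht⟩ := Projectivization.exists_smul_eq_mk_rep k w hw
  have h1 : Proj.coord ⟨Projectivization.mk k v hv⟩ = (s : k) • v := hs.symm
  have h2 : Proj.coord ⟨Projectivization.mk k w hw⟩ = (t : k) • w := ht.symm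
  have key : MvPolynomial.eval (Sum.elim ((s : k) • v) ((t : k) • w)) F =
      ((s : k) ^ a * (t : k) ^ b) * MvPolynomial.eval (Sum.elim v w) F := by
    rw [MvPolynomial.eval_eq, MvPolynomial.eval_eq, Finset.mul_sum]
    refine Finset.sum_congr rfl fun m hm => ?_
    have hdeg := hF (MvPolynomial.mem_support_iff.1 hm)
    rw [Finsupp.weight_apply, Finsupp.sum, Prod.ext_iff, Prod.fst_sum, Prod.snd_sum] at hdeg
    obtain ⟨ha, hb⟩ := hdeg
    have e : ∀ i : σ ⊕ τ, Sum.elim ((s : k) • v) ((t : k) • w) i ^ m i =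
        ((s : k) ^ (m i • (Sum.elim (fun _ => (1, 0)) (fun _ => (0, 1)) i : ℕ × ℕ)).1 *
          (t : k) ^ (m i • (Sum.elim (fun _ => (1, 0)) (fun _ => (0, 1)) i : ℕ × ℕ)).2) *
          Sum.elim v w i ^ m i := by
      rintro (i | i) <;> simp [mul_pow]
    simp only [e, Finset.prod_mul_distrib, Finset.prod_pow_eq_pow_sum]
    simp only at ha hb
    rw [ha, hb]
    ring
  simp [BiProj.zeros, h1, h2, key]

end Zariski

/-! ### Hypersurfaces -/

/-- A hypersurface of a space `X`: a closed subset `S` of pure codimension one, that is, every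
irreducible component of `S` (maximal irreducible closed subset of `X` contained in `S`) has
codimension one in `X`. The codimension of an irreducible closed `Z` is the supremum of the lengths
of the chains of irreducible closed subsets starting from `Z` and going up. -/
def IsHypersurface {X : Type*} [TopologicalSpace X] (S : Set X) : Prop :=
  IsClosed S ∧
    ∀ Z : TopologicalSpace.IrreducibleCloseds X,
      Maximal (fun Y : TopologicalSpace.IrreducibleCloseds X => (Y : Set X) ⊆ S) Z →
        Order.coheight Z = 1

/-! ### Endomorphisms of projective space -/

/-- Exponents `α = (α₀, …, αₙ)` of the monomials of degree `d` in `x₀, …, xₙ`. -/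
abbrev MultiIndex (n d : ℕ) : Type := {α : Fin (n + 1) → ℕ // ∑ l, α l = d}

instance (n d : ℕ) : Fintype (MultiIndex n d) :=
  Fintype.subtype (Finset.Nat.antidiagonalTuple (n + 1) d)
    fun _ => Finset.Nat.mem_antidiagonalTuple

/-- Indices `(i, α)` of the coefficients `f_{i,α}` of an `(n+1)`-tuple of degree-`d` forms. -/
abbrev CoeffIndex (n d : ℕ) : Type := Fin (n + 1) × MultiIndex n d

section Maps

variable (k : Type*) [Field k] (n d : ℕ)

variable {k n d} in
/-- The `i`-th form `f_i = ∑_α f_{i,α} x^α` of the tuple with coefficients `c = (f_{i,α})`. -/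
def form (c : CoeffIndex n d → k) (i : Fin (n + 1)) : MvPolynomial (Fin (n + 1)) k :=
  ∑ α : MultiIndex n d,
    MvPolynomial.C (c (i, α)) * ∏ l : Fin (n + 1), MvPolynomial.X l ^ (α : Fin (n + 1) → ℕ) l

variable {k n d} in
/-- The point `(f₀ : … : fₙ)` of the projective space of tuples of forms of degree `d` is a
morphism `ℙⁿ → ℙⁿ` of degree `d`: the forms have no common zero in `ℙⁿ`. -/
def IsMorphism (f : Proj k (CoeffIndex n d)) : Prop :=
  ∀ x : Fin (n + 1) → k, x ≠ 0 → ∃ i, MvPolynomial.eval x (form f.coord i) ≠ 0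

/-- The parameter space of degree-`d` endomorphisms of `ℙⁿ`, with the Zariski topology induced by
the projective space of tuples of forms. -/
abbrev EndSpace : Type _ := {f : Proj k (CoeffIndex n d) // IsMorphism f}

/-- The product of the parameter space of degree-`d` endomorphisms of `ℙⁿ` with `ℙⁿ`, with its
Zariski topology. -/
abbrev EndTimesProj : Type _ :=
  {x : BiProj k (CoeffIndex n d) (Fin (n + 1)) // IsMorphism x.fst}

/-- The `i`-th form with indeterminate coefficients, `∑_α f_{i,α} x^α`, as a polynomial in the
`f_{i,α}` and the `x_j`. -/
def genericForm (i : Fin (n + 1)) : MvPolynomial (CoeffIndex n d ⊕ Fin (n + 1)) k :=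
  ∑ α : MultiIndex n d, MvPolynomial.X (Sum.inl (i, α)) *
    ∏ l : Fin (n + 1), MvPolynomial.X (Sum.inr l) ^ (α : Fin (n + 1) → ℕ) l

/-- The Jacobian determinant `J = det (∂f_i/∂x_j)`, as a polynomial in the `f_{i,α}` and the
`x_j`. -/
def jacobian : MvPolynomial (CoeffIndex n d ⊕ Fin (n + 1)) k :=
  Matrix.det (Matrix.of fun i j : Fin (n + 1) =>
    MvPolynomial.pderiv (Sum.inr j) (genericForm k n d i))

/-- `V(J)`: the pairs `(f, P)` of a degree-`d` endomorphism `f` of `ℙⁿ` and a critical point `P`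
of `f`. -/
def criticalLocus : Set (EndTimesProj k n d) :=
  {x | (x : BiProj k (CoeffIndex n d) (Fin (n + 1))) ∈ BiProj.zeros (jacobian k n d)}

variable {k n d} in
/-- `(f, P)` lies in `V(J)` exactly when the Jacobian determinant of `(f₀, …, fₙ)` vanishes
at `P`. -/
theorem mem_criticalLocus_iff (x : EndTimesProj k n d) :
    x ∈ criticalLocus k n d ↔
      MvPolynomial.eval x.1.snd.coord (Matrix.det (Matrix.of fun i j : Fin (n + 1) =>
        MvPolynomial.pderiv j (form x.1.fst.coord i))) = 0 := by
  have h : ∀ (c : CoeffIndex n d → k) (p : Fin (n + 1) → k),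
      MvPolynomial.eval (Sum.elim c p) (jacobian k n d) =
        MvPolynomial.eval p (Matrix.det (Matrix.of fun i j : Fin (n + 1) =>
          MvPolynomial.pderiv j (form c i))) := by
    intro c p
    rw [jacobian, RingHom.map_det, RingHom.map_det]
    congr 1
    ext i j
    have e : ∀ α : MultiIndex n d,
        (∏ l : Fin (n + 1), MvPolynomial.X (Sum.inr l) ^ (α : Fin (n + 1) → ℕ) l :
          MvPolynomial (CoeffIndex n d ⊕ Fin (n + 1)) k) =
        MvPolynomial.rename Sum.inr (∏ l : Fin (n + 1), MvPolynomial.X l ^ α.1 l) := by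
      intro α
      simp
    simp only [RingHom.mapMatrix_apply, Matrix.map_apply, Matrix.of_apply, genericForm, form,
      map_sum, Derivation.leibniz, e, MvPolynomial.pderiv_rename Sum.inr_injective,
      MvPolynomial.pderiv_X_of_ne Sum.inl_ne_inr, MvPolynomial.pderiv_C, smul_eq_mul, map_add,
      map_mul, MvPolynomial.eval_X, MvPolynomial.eval_C, Sum.elim_inl, MvPolynomial.eval_rename,
      Sum.elim_comp_inr, mul_zero, map_zero]
  exact (iff_of_eq (congrArg (· = 0) (h _ _)))

variable {k n d} in
/-- Being a morphism does not depend on the homogeneous coordinates. -/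
theorem isMorphism_mk_iff (c : CoeffIndex n d → k) (hc : c ≠ 0) :
    IsMorphism (⟨Projectivization.mk k c hc⟩ : Proj k (CoeffIndex n d)) ↔
      ∀ x : Fin (n + 1) → k, x ≠ 0 → ∃ i, MvPolynomial.eval x (form c i) ≠ 0 := by
  obtain ⟨u, hu⟩ := Projectivization.exists_smul_eq_mk_rep k c hc
  have h : Proj.coord ⟨Projectivization.mk k c hc⟩ = (u : k) • c := hu.symm
  have key : ∀ (x : Fin (n + 1) → k) i,
      MvPolynomial.eval x (form ((u : k) • c) i) = (u : k) * MvPolynomial.eval x (form c i) := by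
    intro x i
    simp [form, Finset.mul_sum, mul_assoc]
  simp [IsMorphism, h, key]

end Maps

end

end MarkedCrit

/-! Irreducibility. A critical pair `(c, x)` has a kernel vector `u` of its Jacobian matrix. For
fixed `x` and `u` the condition that `u` lies in the kernel is linear in `c`, and these equations
have full rank because some monomial has nonzero derivative at `x` along `u`. So the incidence of
triples is a family of linear spaces over the pairs `(x, u)`. Concretely, any two critical pairs lie
on a polynomial curve of solutions of `J = 0` (`exists_curve`): join `c`, `x`, `u` by segments and
correct `c` so that `u` stays in the kernel. As `k` is infinite, two nonvanishing conditions that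
can be met separately can be met together. To land on actual morphisms one further condition is
imposed, that a Macaulay determinant be nonzero; it holds for the power map and excludes common
zeros.

Codimension. Irreducible closed sets correspond, strictly order-reversing, to primes of bi-cones in
the polynomial ring (`conePrime_strictAnti`). The prime of `V(J)` is minimal over `(J)`, so Krull's
principal ideal theorem bounds the codimension by one; it is not zero because the ambient space is
irreducible and has noncritical points.

Dimensions. The upper bounds hold because above the prime of a bi-cone there are two more primes,
and below it the zero ideal when a nonzero equation holds (`length_add_two_le`,
`length_add_three_le`). The lower bounds come from Krull's height theorem at one explicit point of
an affine chart (`card_le_topologicalKrullDim_add`). -/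

namespace MarkedCrit

open MvPolynomial Topology TopologicalSpace

noncomputable section

/-! ### Bi-cones: from irreducible closed sets to prime ideals -/

section Cone

variable {k : Type*} [Field k] {σ τ : Type*}

/-- The bidegrees of the variables of `k[a_σ, x_τ]`. -/
abbrev biWeight (σ τ : Type*) : σ ⊕ τ → ℕ × ℕ := Sum.elim (fun _ => (1, 0)) (fun _ => (0, 1))

theorem Proj.coord_ne_zero (p : Proj k σ) : p.coord ≠ 0 := p.pt.rep_nonzero

/-- Restriction of polynomials to the plane `{(s v, t w)}`, as polynomials in `s` over `k[t]`. -/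
def coneHom (v : σ → k) (w : τ → k) :
    MvPolynomial (σ ⊕ τ) k →ₐ[k] Polynomial (Polynomial k) :=
  aeval (Sum.elim (fun i => Polynomial.C (Polynomial.C (v i)) * Polynomial.X)
    (fun j => Polynomial.C (Polynomial.C (w j) * Polynomial.X)))

theorem coneHom_monomial (v : σ → k) (w : τ → k) (m : σ ⊕ τ →₀ ℕ) (c : k) :
    coneHom v w (monomial m c) =
      Polynomial.monomial (Finsupp.weight (biWeight σ τ) m).1
        (Polynomial.monomial (Finsupp.weight (biWeight σ τ) m).2
          (eval (Sum.elim v w) (monomial m c))) := by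
  have hX : ∀ i n, (Sum.elim (fun i => Polynomial.C (Polynomial.C (v i)) * Polynomial.X)
      (fun j => Polynomial.C (Polynomial.C (w j) * Polynomial.X)) : σ ⊕ τ → _) i ^ n =
      Polynomial.C (Polynomial.C (Sum.elim v w i ^ n)) *
        (Polynomial.X ^ (n • biWeight σ τ i).1 *
          Polynomial.C (Polynomial.X ^ (n • biWeight σ τ i).2)) := by
    rintro (i | i) n <;> simp [mul_pow]
  rw [coneHom, aeval_monomial, eval_monomial, Finsupp.prod, Finsupp.prod, Finsupp.weight_apply,
    Finsupp.sum, Prod.fst_sum, Prod.snd_sum]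
  simp only [hX, Finset.prod_mul_distrib, Finset.prod_pow_eq_pow_sum, ← map_prod]
  rw [← Polynomial.C_mul_X_pow_eq_monomial, ← Polynomial.C_mul_X_pow_eq_monomial,
    IsScalarTower.algebraMap_apply k (Polynomial k), Polynomial.algebraMap_eq,
    Polynomial.algebraMap_eq]
  simp only [map_mul, map_prod]
  ring

/-- The exponents of `s` and `t` record the bidegree. Hence a polynomial vanishes on the plane
exactly when all its bihomogeneous components vanish at `(v, w)`. -/
theorem coeff_coneHom (v : σ → k) (w : τ → k) (P : MvPolynomial (σ ⊕ τ) k) (a b : ℕ) :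
    ((coneHom v w P).coeff a).coeff b =
      eval (Sum.elim v w) (weightedHomogeneousComponent (biWeight σ τ) (a, b) P) := by
  classical
  induction P using MvPolynomial.induction_on' with
  | add p q hp hq => simp [hp, hq]
  | monomial m c =>
    rw [coneHom_monomial]
    have hm := isWeightedHomogeneous_monomial (biWeight σ τ) m c rfl
    rw [weightedHomogeneousComponent_of_mem (m := (a, b)) hm, Polynomial.coeff_monomial]
    by_cases h1 : (Finsupp.weight (biWeight σ τ) m).1 = a <;>
    by_cases h2 : (Finsupp.weight (biWeight σ τ) m).2 = b <;>
    simp [h1, h2, Prod.ext_iff, Polynomial.coeff_monomial, eq_comm (a := a), eq_comm (a := b)]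

theorem coneHom_eq_zero_iff {v : σ → k} {w : τ → k} {F : MvPolynomial (σ ⊕ τ) k} {a b : ℕ}
    (hF : IsBihomogeneous F a b) : coneHom v w F = 0 ↔ eval (Sum.elim v w) F = 0 := by
  constructor
  · intro h
    have := coeff_coneHom v w F a b
    rw [h, IsWeightedHomogeneous.weightedHomogeneousComponent_same hF] at this
    simpa using this.symm
  · intro h
    ext a' b'
    rw [coeff_coneHom]
    by_cases hab : (a', b') = (a, b)
    · rw [hab, IsWeightedHomogeneous.weightedHomogeneousComponent_same hF, h]; simp
    · rw [IsWeightedHomogeneous.weightedHomogeneousComponent_ne _ hF hab]; simp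

theorem exists_bihomogeneous_of_coneHom_ne_zero {v : σ → k} {w : τ → k}
    {P : MvPolynomial (σ ⊕ τ) k} (h : coneHom v w P ≠ 0) :
    ∃ (F : MvPolynomial (σ ⊕ τ) k) (a b : ℕ), IsBihomogeneous F a b ∧
      eval (Sum.elim v w) F ≠ 0 ∧
      ∀ (v' : σ → k) (w' : τ → k), eval (Sum.elim v' w') F ≠ 0 → coneHom v' w' P ≠ 0 := by
  have : ∃ a b, ((coneHom v w P).coeff a).coeff b ≠ 0 := by
    by_contra! h'
    exact h (by ext a b; simp [h'])
  obtain ⟨a, b, hab⟩ := this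
  refine ⟨weightedHomogeneousComponent (biWeight σ τ) (a, b) P, a, b,
    weightedHomogeneousComponent_isWeightedHomogeneous (w := biWeight σ τ) (a, b) P, by rwa [← coeff_coneHom], ?_⟩
  intro v' w' h' h0
  rw [← coeff_coneHom, h0] at h'
  simp at h'

theorem coneHom_ne_zero_of_eval_ne_zero {v : σ → k} {w : τ → k} {P : MvPolynomial (σ ⊕ τ) k}
    (s t : k) (h : eval (Sum.elim (s • v) (t • w)) P ≠ 0) : coneHom v w P ≠ 0 := by
  intro h0
  apply h
  have : (eval (Sum.elim (s • v) (t • w)) : MvPolynomial (σ ⊕ τ) k →+* k) =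
      ((Polynomial.evalRingHom t).comp (Polynomial.evalRingHom (Polynomial.C s))).comp
        (coneHom v w).toRingHom := by
    ext i
    · simp
    · rcases i with i | i <;> simp [coneHom] <;> ring
  rw [this]
  simp [h0]

/-- The basic open sets form a base of the Zariski topology. -/
theorem BiProj.exists_basic_subset {U : Set (BiProj k σ τ)} (hU : IsOpen U) {z : BiProj k σ τ}
    (hz : z ∈ U) : ∃ (F : MvPolynomial (σ ⊕ τ) k) (a b : ℕ), IsBihomogeneous F a b ∧
      z ∉ BiProj.zeros F ∧ (BiProj.zeros F)ᶜ ⊆ U := by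
  induction hU with
  | basic s hs =>
    obtain ⟨F, a, b, hF, rfl⟩ := hs
    exact ⟨F, a, b, hF, hz, subset_rfl⟩
  | univ => exact ⟨1, 0, 0, isWeightedHomogeneous_one _ _, by simp [BiProj.zeros], by simp⟩
  | inter s t _ _ ihs iht =>
    obtain ⟨F, a, b, hF, hzF, hFs⟩ := ihs hz.1
    obtain ⟨G, a', b', hG, hzG, hGt⟩ := iht hz.2
    refine ⟨F * G, a + a', b + b', hF.mul hG, ?_, fun y hy => ?_⟩
    · simp only [BiProj.zeros, Set.mem_ofPred_eq, map_mul, mul_eq_zero, not_or] at *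
      exact ⟨hzF, hzG⟩
    · simp only [BiProj.zeros, Set.mem_compl_iff, Set.mem_ofPred_eq, map_mul, mul_eq_zero,
        not_or] at hy
      exact ⟨hFs hy.1, hGt hy.2⟩
  | sUnion S _ ih =>
    obtain ⟨s, hs, hzs⟩ := hz
    obtain ⟨F, a, b, hF, hzF, hFs⟩ := ih s hs hzs
    exact ⟨F, a, b, hF, hzF, hFs.trans (Set.subset_sUnion_of_mem hs)⟩

theorem BiProj.isOpen_compl_zeros {F : MvPolynomial (σ ⊕ τ) k} {a b : ℕ}
    (hF : IsBihomogeneous F a b) : IsOpen (BiProj.zeros F)ᶜ :=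
  isOpen_generateFrom_of_mem ⟨F, a, b, hF, rfl⟩

/-- The ideal of the polynomials vanishing on the bi-cone over `S`. -/
def coneIdeal (S : Set (BiProj k σ τ)) : Ideal (MvPolynomial (σ ⊕ τ) k) :=
  ⨅ z ∈ S, RingHom.ker (coneHom z.fst.coord z.snd.coord)

theorem mem_coneIdeal {S : Set (BiProj k σ τ)} {P : MvPolynomial (σ ⊕ τ) k} :
    P ∈ coneIdeal S ↔ ∀ z ∈ S, coneHom z.fst.coord z.snd.coord P = 0 := by
  simp [coneIdeal, Submodule.mem_iInf]

theorem coneIdeal_anti {S T : Set (BiProj k σ τ)} (h : S ⊆ T) : coneIdeal T ≤ coneIdeal S :=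
  fun _ hP => mem_coneIdeal.2 fun z hz => mem_coneIdeal.1 hP z (h hz)

/-- If neither `P` nor `Q` vanishes on the bi-cone, each has a bihomogeneous component that is
nonzero somewhere on `S`. The two resulting open sets meet in `S`, and there `P * Q` is nonzero
because `k[t][s]` is a domain. -/
theorem coneIdeal_isPrime {S : Set (BiProj k σ τ)} (hS : IsIrreducible S) :
    (coneIdeal S).IsPrime := by
  refine ⟨?_, ?_⟩
  · obtain ⟨z, hz⟩ := hS.1
    intro h
    have := mem_coneIdeal.1 ((Ideal.eq_top_iff_one _).1 h) z hz
    simp at this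
  · intro P Q hPQ
    by_contra! h
    obtain ⟨hP, hQ⟩ := h
    simp only [mem_coneIdeal, not_forall] at hP hQ
    obtain ⟨z, hz, hPz⟩ := hP
    obtain ⟨y, hy, hQy⟩ := hQ
    obtain ⟨F, a, b, hF, hFz, hFP⟩ := exists_bihomogeneous_of_coneHom_ne_zero hPz
    obtain ⟨G, a', b', hG, hGy, hGQ⟩ := exists_bihomogeneous_of_coneHom_ne_zero hQy
    obtain ⟨x, hxS, hxF, hxG⟩ := hS.2 _ _ (BiProj.isOpen_compl_zeros hF)
      (BiProj.isOpen_compl_zeros hG) ⟨z, hz, hFz⟩ ⟨y, hy, hGy⟩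
    have := mem_coneIdeal.1 hPQ x hxS
    rw [map_mul, mul_eq_zero] at this
    exact this.elim (hFP _ _ hxF) (hGQ _ _ hxG)

variable {Y : Type*} [TopologicalSpace Y] {e : Y → BiProj k σ τ}

/-- The prime ideal of the bi-cone over an irreducible closed subset. -/
def conePrime (he : IsInducing e) (Z : IrreducibleCloseds Y) :
    PrimeSpectrum (MvPolynomial (σ ⊕ τ) k) :=
  ⟨coneIdeal (e '' Z), coneIdeal_isPrime (Z.isIrreducible.image e he.continuous.continuousOn)⟩

/-- Strictness holds because a point outside the closed set `Z` is separated from it by a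
bihomogeneous polynomial. -/
theorem conePrime_strictAnti (he : IsInducing e) : StrictAnti (conePrime he) := by
  intro Z W hZW
  rw [← PrimeSpectrum.asIdeal_lt_asIdeal]
  refine lt_of_le_of_ne (coneIdeal_anti (Set.image_mono hZW.le)) fun h => ?_
  obtain ⟨y, hyW, hyZ⟩ := Set.exists_of_ssubset (show (Z : Set Y) ⊂ W from hZW)
  obtain ⟨U, hU, hUZ⟩ := he.isOpen_iff.1 Z.isClosed.isOpen_compl
  obtain ⟨F, a, b, hF, hyF, hFU⟩ := BiProj.exists_basic_subset hU (z := e y)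
    (by rw [← Set.mem_preimage, hUZ]; exact hyZ)
  have hFZ : F ∈ coneIdeal (e '' Z) := by
    rw [mem_coneIdeal]
    rintro _ ⟨z, hz, rfl⟩
    rw [coneHom_eq_zero_iff hF]
    by_contra h'
    have : z ∈ e ⁻¹' U := hFU h'
    rw [hUZ] at this
    exact this hz
  have hFW : F ∈ coneIdeal (e '' W) := by
    have h' : coneIdeal (e '' W) = coneIdeal (e '' Z) := h
    rwa [h']
  exact hyF ((coneHom_eq_zero_iff hF).1 (mem_coneIdeal.1 hFW _ ⟨y, hyW, rfl⟩))

end Cone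

/-! ### Heights of points of affine space -/

section Heights

variable {k : Type*} [Field k] {ι : Type*}

theorem ringKrullDim_mvPolynomial_field [Finite ι] :
    ringKrullDim (MvPolynomial ι k) = (Nat.card ι : WithBot ℕ∞) := by
  rw [MvPolynomial.ringKrullDim_of_isNoetherianRing, ringKrullDim_eq_zero_of_field, zero_add]

/-- Translation by `b`, as an automorphism of the polynomial ring. -/
def translate (b : ι → k) : MvPolynomial ι k ≃ₐ[k] MvPolynomial ι k :=
  AlgEquiv.ofAlgHom (aeval fun i => X i + C (b i)) (aeval fun i => X i - C (b i))
    (by ext i : 1; simp [algebraMap_eq]) (by ext i : 1; simp [algebraMap_eq])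

/-- Over an algebraically closed field all points of affine space have the same height. -/
theorem height_vanishingIdeal_singleton [IsAlgClosed k] [Finite ι] (b : ι → k) :
    (vanishingIdeal k {b} : Ideal (MvPolynomial ι k)).height = (Nat.card ι : ℕ∞) := by
  have hdim := ringKrullDim_mvPolynomial_field (k := k) (ι := ι)
  have : FiniteRingKrullDim (MvPolynomial ι k) := by
    rw [finiteRingKrullDim_iff_ne_bot_and_top, hdim]
    exact ⟨by simp, fun h => ENat.natCast_ne_top _ (WithBot.coe_injective h)⟩
  -- Some maximal ideal attains the Krull dimension. By the Nullstellensatz it is the ideal of a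
  -- point `x`, and a translation carries it to that of `b`.
  obtain ⟨p, hp, hh⟩ := Ideal.exists_isMaximal_height (R := MvPolynomial ι k)
  obtain ⟨x, rfl⟩ := eq_vanishingIdeal_singleton_of_isMaximal k hp
  rw [hdim] at hh
  have hh' : (vanishingIdeal k {x} : Ideal (MvPolynomial ι k)).height = (Nat.card ι : ℕ∞) := by
    exact_mod_cast hh
  rw [← hh', ← RingEquiv.height_comap (translate (x - b)).toRingEquiv]
  congr 1
  ext P
  have hP : eval b (translate (x - b) P) = eval x P := by
    change eval b (aeval (fun i => X i + C ((x - b) i)) P) = eval x P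
    induction P using MvPolynomial.induction_on with
    | C a => simp
    | add p q hp hq => simp_all
    | mul_X p i hp => rw [map_mul, map_mul, hp, map_mul]; simp
  simp [Ideal.mem_comap, hP, aeval_eq_eval]

end Heights

/-! ### Upper and lower bounds for dimensions -/

section Dimension

variable {k : Type*} [Field k] {σ τ : Type*}

/-- Every polynomial agrees with a bihomogeneous one on a standard affine chart. -/
theorem exists_bihomogenization (s₀ : σ) (t₀ : τ) (P : MvPolynomial (σ ⊕ τ) k) :
    ∃ (F : MvPolynomial (σ ⊕ τ) k) (a b : ℕ), IsBihomogeneous F a b ∧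
      ∀ (v : σ → k) (w : τ → k), v s₀ = 1 → w t₀ = 1 →
        eval (Sum.elim v w) F = eval (Sum.elim v w) P := by
  have hs : IsBihomogeneous (X (Sum.inl s₀) : MvPolynomial (σ ⊕ τ) k) 1 0 :=
    isWeightedHomogeneous_X k (biWeight σ τ) _
  have ht : IsBihomogeneous (X (Sum.inr t₀) : MvPolynomial (σ ⊕ τ) k) 0 1 :=
    isWeightedHomogeneous_X k (biWeight σ τ) _
  induction P using MvPolynomial.induction_on with
  | C c => exact ⟨C c, 0, 0, isWeightedHomogeneous_C _ _, fun _ _ _ _ => rfl⟩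
  | add P Q hP hQ =>
    obtain ⟨F, a, b, hF, hFP⟩ := hP
    obtain ⟨G, a', b', hG, hGQ⟩ := hQ
    refine ⟨F * (X (Sum.inl s₀) ^ a' * X (Sum.inr t₀) ^ b') +
      G * (X (Sum.inl s₀) ^ a * X (Sum.inr t₀) ^ b), a + a', b + b', ?_, ?_⟩
    · refine IsWeightedHomogeneous.add ?_ ?_
      · convert hF.mul ((hs.pow a').mul (ht.pow b')) using 1
        simp
      · convert hG.mul ((hs.pow a).mul (ht.pow b)) using 1
        simp [add_comm]
    · intro v w hv hw
      simp [hv, hw, hFP v w hv hw, hGQ v w hv hw]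
  | mul_X P i hP =>
    obtain ⟨F, a, b, hF, hFP⟩ := hP
    refine ⟨F * X i, (a, b).1 + (biWeight σ τ i).1, (a, b).2 + (biWeight σ τ i).2,
      hF.mul (isWeightedHomogeneous_X k (biWeight σ τ) i), ?_⟩
    intro v w hv hw
    simp [hFP v w hv hw]

variable {Y : Type*} {e : Y → BiProj k σ τ}

/-- The point of `ℙ(k ^ σ) × ℙ(k ^ τ)` with given homogeneous coordinates. -/
abbrev BiProj.ofVec (v : σ → k) (hv : v ≠ 0) (w : τ → k) (hw : w ≠ 0) : BiProj k σ τ :=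
  ⟨⟨Projectivization.mk k v hv⟩, ⟨Projectivization.mk k w hw⟩⟩

/-- The points of `Y` lying in a standard affine chart, in the zero locus of `I` and off the zero
locus of `R`. -/
def chartLocus (e : Y → BiProj k σ τ) (s₀ : σ) (t₀ : τ) (R : MvPolynomial (σ ⊕ τ) k)
    (I : Ideal (MvPolynomial (σ ⊕ τ) k)) : Set Y :=
  {y | ∃ (v : σ → k) (hv : v ≠ 0) (w : τ → k) (hw : w ≠ 0), v s₀ = 1 ∧ w t₀ = 1 ∧
    (∀ P ∈ I, eval (Sum.elim v w) P = 0) ∧ eval (Sum.elim v w) R ≠ 0 ∧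
    e y = BiProj.ofVec v hv w hw}

/-- Nullstellensatz: since `I` is prime, `R * Q` lies outside it and so is nonzero at some zero of
`I`. The two linear elements of `I` put that zero in the chart. -/
theorem exists_mem_chartLocus [Fintype σ] [Fintype τ] [IsAlgClosed k] {T : Finset (MvPolynomial (σ ⊕ τ) k)}
    {R : MvPolynomial (σ ⊕ τ) k} {s₀ : σ} {t₀ : τ}
    (hY : ∀ (v : σ → k) (hv : v ≠ 0) (w : τ → k) (hw : w ≠ 0), v s₀ = 1 → w t₀ = 1 →
      (∀ P ∈ T, eval (Sum.elim v w) P = 0) → eval (Sum.elim v w) R ≠ 0 →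
      BiProj.ofVec v hv w hw ∈ Set.range e)
    {I : Ideal (MvPolynomial (σ ⊕ τ) k)} (hI : I.IsPrime) (hs : X (Sum.inl s₀) - 1 ∈ I)
    (ht : X (Sum.inr t₀) - 1 ∈ I) (hT : ∀ P ∈ T, P ∈ I) (hR : R ∉ I)
    {Q : MvPolynomial (σ ⊕ τ) k} (hQ : Q ∉ I) :
    ∃ y ∈ chartLocus e s₀ t₀ R I, ∃ (v : σ → k) (hv : v ≠ 0) (w : τ → k) (hw : w ≠ 0),
      v s₀ = 1 ∧ w t₀ = 1 ∧ e y = BiProj.ofVec v hv w hw ∧ eval (Sum.elim v w) Q ≠ 0 := by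
  have hRQ : R * Q ∉ I := fun h => (hI.mem_or_mem h).elim hR hQ
  rw [← IsPrime.vanishingIdeal_zeroLocus (K := k) I] at hRQ
  simp only [mem_vanishingIdeal_iff, mem_zeroLocus_iff, not_forall] at hRQ
  obtain ⟨x, hx, hxRQ⟩ := hRQ
  obtain ⟨v, w, rfl⟩ : ∃ v w, x = Sum.elim v w :=
    ⟨x ∘ Sum.inl, x ∘ Sum.inr, (Sum.elim_comp_inl_inr x).symm⟩
  simp only [aeval_eq_eval, map_mul, mul_eq_zero, not_or] at hx hxRQ
  have hv : v s₀ = 1 := by simpa [sub_eq_zero] using hx _ hs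
  have hw : w t₀ = 1 := by simpa [sub_eq_zero] using hx _ ht
  have hv0 : v ≠ 0 := fun h => by simp [h] at hv
  have hw0 : w ≠ 0 := fun h => by simp [h] at hw
  obtain ⟨y, hy⟩ := hY v hv0 w hw0 hv hw (fun P hP => hx P (hT P hP)) hxRQ.1
  exact ⟨y, ⟨v, hv0, w, hw0, hv, hw, hx, hxRQ.1, hy⟩, v, hv0, w, hw0, hv, hw, hy, hxRQ.2⟩

variable [TopologicalSpace Y]

theorem exists_series_conePrime (he : IsInducing e) (p : LTSeries (IrreducibleCloseds Y)) :
    ∃ q : LTSeries (PrimeSpectrum (MvPolynomial (σ ⊕ τ) k)), q.length = p.length ∧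
      q.last = conePrime he p.head ∧ q.head = conePrime he p.last := by
  refine ⟨LTSeries.mk p.length (fun i => conePrime he (p i.rev)) fun i j hij =>
    conePrime_strictAnti he (p.strictMono (Fin.rev_lt_rev.2 hij)), rfl, ?_, ?_⟩
  · exact congrArg (fun i => conePrime he (p i)) (Fin.rev_last p.length)
  · exact congrArg (fun i => conePrime he (p i)) (Fin.rev_zero p.length)

variable [Fintype σ] [Fintype τ]

/-- Over a point `(v, w)` of `S` the bi-cone contains the plane `{(s v, t w)}`. Setting `s = 0`, and
then `t = 0`, gives two strictly larger primes. -/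
theorem height_coneIdeal_add_two_le {S : Set (BiProj k σ τ)} (hS : S.Nonempty)
    (p : PrimeSpectrum (MvPolynomial (σ ⊕ τ) k)) (hp : p.asIdeal = coneIdeal S) :
    Order.height p + 2 ≤ (Fintype.card σ + Fintype.card τ : ℕ) := by
  obtain ⟨z, hz⟩ := hS
  set v := z.fst.coord
  set w := z.snd.coord
  obtain ⟨i, hi⟩ := Function.ne_iff.1 z.fst.coord_ne_zero
  obtain ⟨j, hj⟩ := Function.ne_iff.1 z.snd.coord_ne_zero
  let f₁ := (Polynomial.evalRingHom (0 : Polynomial k)).comp (coneHom v w).toRingHom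
  let f₂ := (Polynomial.evalRingHom (0 : k)).comp f₁
  let q₁ : PrimeSpectrum (MvPolynomial (σ ⊕ τ) k) := ⟨RingHom.ker f₁, RingHom.ker_isPrime _⟩
  let q₂ : PrimeSpectrum (MvPolynomial (σ ⊕ τ) k) := ⟨RingHom.ker f₂, RingHom.ker_isPrime _⟩
  have h₁ : p < q₁ := by
    rw [← PrimeSpectrum.asIdeal_lt_asIdeal, hp]
    refine SetLike.lt_iff_le_and_exists.2 ⟨fun P hP => ?_, X (Sum.inl i), ?_, fun h => ?_⟩
    · have := mem_coneIdeal.1 hP z hz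
      simp [q₁, f₁, v, w, RingHom.mem_ker, this]
    · simp [q₁, f₁, RingHom.mem_ker, coneHom]
    · have := mem_coneIdeal.1 h z hz
      simp only [coneHom, aeval_X, Sum.elim_inl, mul_eq_zero, Polynomial.C_eq_zero,
        Polynomial.X_ne_zero, or_false] at this
      exact hi this
  have h₂ : q₁ < q₂ := by
    rw [← PrimeSpectrum.asIdeal_lt_asIdeal]
    refine SetLike.lt_iff_le_and_exists.2 ⟨fun P hP => ?_, X (Sum.inr j), ?_, fun h => ?_⟩
    · rw [RingHom.mem_ker] at hP ⊢
      simp [f₂, hP]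
    · simp [q₂, f₂, f₁, RingHom.mem_ker, coneHom]
    · simp only [q₁, f₁, RingHom.mem_ker, coneHom] at h
      simp at h
      exact hj h
  have h₃ := Order.height_le_krullDim q₂
  have h₄ := ringKrullDim_mvPolynomial_field (k := k) (ι := σ ⊕ τ)
  rw [ringKrullDim] at h₄
  rw [h₄, Nat.card_eq_fintype_card, Fintype.card_sum] at h₃
  have h₅ : Order.height q₂ ≤ (Fintype.card σ + Fintype.card τ : ℕ) := by exact_mod_cast h₃
  calc Order.height p + 2 = Order.height p + 1 + 1 := by rw [add_assoc]; rfl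
    _ ≤ Order.height q₁ + 1 := by gcongr; exact Order.height_add_one_le h₁
    _ ≤ Order.height q₂ := Order.height_add_one_le h₂
    _ ≤ _ := h₅

theorem length_add_two_le (he : IsInducing e) (p : LTSeries (IrreducibleCloseds Y)) :
    p.length + 2 ≤ Fintype.card σ + Fintype.card τ := by
  obtain ⟨q, hq, hlast, -⟩ := exists_series_conePrime he p
  have h₁ := height_coneIdeal_add_two_le (p.head.isIrreducible.nonempty.image e)
    (conePrime he p.head) rfl
  have h₂ : (q.length : ℕ∞) ≤ Order.height (conePrime he p.head) :=
    hlast ▸ Order.length_le_height_last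
  rw [hq] at h₂
  exact_mod_cast (add_le_add_left h₂ 2).trans h₁

theorem length_add_three_le (he : IsInducing e) (p : LTSeries (IrreducibleCloseds Y))
    {P : MvPolynomial (σ ⊕ τ) k} (hP : P ≠ 0)
    (hPe : ∀ y, coneHom (e y).fst.coord (e y).snd.coord P = 0) :
    p.length + 3 ≤ Fintype.card σ + Fintype.card τ := by
  obtain ⟨q, hq, hlast, hhead⟩ := exists_series_conePrime he p
  -- All primes of the chain contain `P`, so the zero ideal extends it by one more step.
  have h₀ : (⊥ : PrimeSpectrum (MvPolynomial (σ ⊕ τ) k)) < q.head := by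
    rw [bot_lt_iff_ne_bot, hhead]
    intro h
    have : P ∈ (conePrime he p.last).asIdeal := by
      refine mem_coneIdeal.2 ?_
      rintro _ ⟨y, -, rfl⟩
      exact hPe y
    rw [h] at this
    exact hP this
  have h₁ := height_coneIdeal_add_two_le (p.head.isIrreducible.nonempty.image e)
    (conePrime he p.head) rfl
  have h₂ : ((q.cons ⊥ h₀).length : ℕ∞) ≤ Order.height (conePrime he p.head) := by
    rw [← hlast, ← RelSeries.last_cons q ⊥ h₀]
    exact Order.length_le_height_last
  rw [RelSeries.cons_length, hq] at h₂
  exact_mod_cast (add_le_add_left h₂ 2).trans h₁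

theorem isIrreducible_chartLocus [IsAlgClosed k] (he : IsInducing e)
    {T : Finset (MvPolynomial (σ ⊕ τ) k)}
    {R : MvPolynomial (σ ⊕ τ) k} {s₀ : σ} {t₀ : τ}
    (hY : ∀ (v : σ → k) (hv : v ≠ 0) (w : τ → k) (hw : w ≠ 0), v s₀ = 1 → w t₀ = 1 →
      (∀ P ∈ T, eval (Sum.elim v w) P = 0) → eval (Sum.elim v w) R ≠ 0 →
      BiProj.ofVec v hv w hw ∈ Set.range e)
    {I : Ideal (MvPolynomial (σ ⊕ τ) k)} (hI : I.IsPrime) (hs : X (Sum.inl s₀) - 1 ∈ I)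
    (ht : X (Sum.inr t₀) - 1 ∈ I) (hT : ∀ P ∈ T, P ∈ I) (hR : R ∉ I) :
    IsIrreducible (chartLocus e s₀ t₀ R I) := by
  refine ⟨?_, ?_⟩
  · obtain ⟨y, hy, -⟩ := exists_mem_chartLocus hY hI hs ht hT hR
      (Q := 1) fun h => hI.ne_top ((Ideal.eq_top_iff_one _).2 h)
    exact ⟨y, hy⟩
  · have key : ∀ U : Set Y, IsOpen U → (chartLocus e s₀ t₀ R I ∩ U).Nonempty →
        ∃ (F : MvPolynomial (σ ⊕ τ) k) (a b : ℕ), IsBihomogeneous F a b ∧ F ∉ I ∧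
          e ⁻¹' (BiProj.zeros F)ᶜ ⊆ U := by
      rintro U hU ⟨y, ⟨v, hv, w, hw, -, -, hI', -, hy⟩, hyU⟩
      obtain ⟨U', hU', rfl⟩ := he.isOpen_iff.1 hU
      obtain ⟨F, a, b, hF, hyF, hFU⟩ := BiProj.exists_basic_subset hU' hyU
      refine ⟨F, a, b, hF, fun h => hyF ?_, Set.preimage_mono hFU⟩
      rw [hy, BiProj.ofVec, BiProj.mem_zeros_iff hF]
      exact hI' F h
    intro U V hU hV hUn hVn
    obtain ⟨F, a, b, hF, hFI, hFU⟩ := key U hU hUn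
    obtain ⟨G, a', b', hG, hGI, hGV⟩ := key V hV hVn
    obtain ⟨y, hy, v, hv, w, hw, -, -, hyv, hFG⟩ := exists_mem_chartLocus hY hI hs ht hT hR
      (Q := F * G) fun h => (hI.mem_or_mem h).elim hFI hGI
    rw [map_mul, mul_ne_zero_iff] at hFG
    refine ⟨y, hy, hFU ?_, hGV ?_⟩
    · rw [Set.mem_preimage, hyv, Set.mem_compl_iff, BiProj.ofVec, BiProj.mem_zeros_iff hF]
      exact hFG.1
    · rw [Set.mem_preimage, hyv, Set.mem_compl_iff, BiProj.ofVec, BiProj.mem_zeros_iff hG]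
      exact hFG.2

/-- A lower bound for the dimension of a space which contains, near one point, the zero locus of
finitely many polynomials. -/
theorem card_le_topologicalKrullDim_add [IsAlgClosed k] (he : IsInducing e)
    (T : Finset (MvPolynomial (σ ⊕ τ) k)) (R : MvPolynomial (σ ⊕ τ) k) (s₀ : σ) (t₀ : τ)
    (hY : ∀ (v : σ → k) (hv : v ≠ 0) (w : τ → k) (hw : w ≠ 0), v s₀ = 1 → w t₀ = 1 →
      (∀ P ∈ T, eval (Sum.elim v w) P = 0) → eval (Sum.elim v w) R ≠ 0 →
      BiProj.ofVec v hv w hw ∈ Set.range e)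
    (v₀ : σ → k) (w₀ : τ → k) (hv₀ : v₀ s₀ = 1) (hw₀ : w₀ t₀ = 1)
    (hT₀ : ∀ P ∈ T, eval (Sum.elim v₀ w₀) P = 0) (hR₀ : eval (Sum.elim v₀ w₀) R ≠ 0) :
    ((Fintype.card σ + Fintype.card τ : ℕ) : WithBot ℕ∞) ≤
      topologicalKrullDim Y + ((T.card + 2 : ℕ) : WithBot ℕ∞) := by
  classical
  let m : Ideal (MvPolynomial (σ ⊕ τ) k) := vanishingIdeal k {Sum.elim v₀ w₀}
  have hm : ∀ P, P ∈ m ↔ eval (Sum.elim v₀ w₀) P = 0 := fun P => by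
    simp [m, aeval_eq_eval]
  -- The equations of `T` restricted to the chart: the two dehomogenizing equations account for the
  -- `2` in the bound.
  let s : Finset (MvPolynomial (σ ⊕ τ) k) := insert (X (Sum.inl s₀) - 1)
    (insert (X (Sum.inr t₀) - 1) T)
  have hsm : (s : Set (MvPolynomial (σ ⊕ τ) k)) ⊆ m := by
    intro P hP
    simp only [s, Finset.coe_insert, Set.mem_insert_iff, Finset.mem_coe] at hP
    rw [SetLike.mem_coe, hm]
    rcases hP with rfl | rfl | hP
    · simp [hv₀]
    · simp [hw₀]
    · exact hT₀ P hP
  let π := Ideal.Quotient.mk (Ideal.span (s : Set (MvPolynomial (σ ⊕ τ) k)))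
  have hmp : (m.map π).IsPrime :=
    Ideal.isPrime_map_quotientMk_of_isPrime (Ideal.span_le.2 hsm)
  have hmm : (m.map π).comap π = m := by
    rw [Ideal.comap_map_of_surjective π Ideal.Quotient.mk_surjective, sup_eq_left,
      ← RingHom.ker_eq_comap_bot, Ideal.mk_ker]
    exact Ideal.span_le.2 hsm
  have hheight := Ideal.height_le_height_add_encard_of_subset (p := m) (s : Set _) hsm
  rw [height_vanishingIdeal_singleton, Set.encard_coe_eq_coe_finsetCard,
    Nat.card_eq_fintype_card, Fintype.card_sum] at hheight
  have hscard : s.card ≤ T.card + 2 := by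
    refine (Finset.card_insert_le _ _).trans ?_
    have := Finset.card_insert_le (X (Sum.inr t₀) - 1) T
    omega
  have hmem : ∀ q : PrimeSpectrum (MvPolynomial (σ ⊕ τ) k ⧸ Ideal.span (s : Set _)),
      ∀ P ∈ s, P ∈ q.asIdeal.comap π := by
    intro q P hP
    rw [Ideal.mem_comap, Ideal.Quotient.eq_zero_iff_mem.2 (Ideal.subset_span hP)]
    exact q.asIdeal.zero_mem
  let M : PrimeSpectrum (MvPolynomial (σ ⊕ τ) k ⧸ Ideal.span (s : Set _)) := ⟨m.map π, hmp⟩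
  have hRq : ∀ q : Set.Iic M, R ∉ q.1.asIdeal.comap π := by
    intro q h
    have h' : R ∈ (m.map π).comap π := Ideal.comap_mono (f := π) q.2 h
    rw [hmm, hm] at h'
    exact hR₀ h'
  have hirr : ∀ q : Set.Iic M, IsIrreducible (chartLocus e s₀ t₀ R (q.1.asIdeal.comap π)) :=
    fun q => isIrreducible_chartLocus he hY (q.1.2.comap π) (hmem _ _ (by simp [s]))
      (hmem _ _ (by simp [s])) (fun P hP => hmem _ _ (by simp [s, hP])) (hRq q)
  -- Primes below `M` avoid `R`, so their chart loci are nonempty and irreducible. Distinct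
  -- comparable primes have distinct closures, as a separating polynomial can be bihomogenized.
  let Φ : Set.Iic M → (IrreducibleCloseds Y)ᵒᵈ := fun q =>
    OrderDual.toDual ⟨closure (chartLocus e s₀ t₀ R (q.1.asIdeal.comap π)),
      (hirr q).closure, isClosed_closure⟩
  have hΦ : StrictMono Φ := by
    intro p q hpq
    have hpq' : p.1.asIdeal < q.1.asIdeal := hpq
    refine OrderDual.toDual_lt_toDual.2 ?_
    change closure (chartLocus e s₀ t₀ R (q.1.asIdeal.comap π)) ⊂
      closure (chartLocus e s₀ t₀ R (p.1.asIdeal.comap π))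
    refine (Set.ssubset_iff_of_subset (closure_mono ?_)).2 ?_
    · rintro y ⟨v, hv, w, hw, h1, h2, h3, h4, h5⟩
      exact ⟨v, hv, w, hw, h1, h2, fun P hP => h3 P (Ideal.comap_mono hpq'.le hP), h4, h5⟩
    · obtain ⟨r, hrq, hrp⟩ := SetLike.exists_of_lt hpq'
      obtain ⟨P, rfl⟩ := Ideal.Quotient.mk_surjective r
      obtain ⟨F, a, b, hF, hFP⟩ := exists_bihomogenization s₀ t₀ P
      obtain ⟨y, hy, v, hv, w, hw, hvs, hwt, hyv, hPv⟩ := exists_mem_chartLocus hY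
        (p.1.2.comap π) (hmem _ _ (by simp [s])) (hmem _ _ (by simp [s]))
        (fun P hP => hmem _ _ (by simp [s, hP])) (hRq p) (Q := P) hrp
      refine ⟨y, subset_closure hy, fun hy' => ?_⟩
      have hcl : IsClosed (e ⁻¹' BiProj.zeros F) :=
        (isOpen_compl_iff.1 (BiProj.isOpen_compl_zeros hF)).preimage he.continuous
      have hsub : chartLocus e s₀ t₀ R (q.1.asIdeal.comap π) ⊆ e ⁻¹' BiProj.zeros F := by
        rintro y' ⟨v', hv', w', hw', h1, h2, h3, -, h5⟩
        rw [Set.mem_preimage, h5, BiProj.ofVec, BiProj.mem_zeros_iff hF, hFP v' w' h1 h2]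
        exact h3 P hrq
      have := closure_minimal hsub hcl hy'
      rw [Set.mem_preimage, hyv, BiProj.ofVec, BiProj.mem_zeros_iff hF, hFP v w hvs hwt] at this
      exact hPv this
  have hdim : (Order.height M : WithBot ℕ∞) ≤ topologicalKrullDim Y := by
    rw [Order.height_eq_krullDim_Iic]
    exact (Order.krullDim_le_of_strictMono Φ hΦ).trans_eq Order.krullDim_orderDual
  have hM : (m.map π).height = Order.height M := by
    exact PrimeSpectrum.height_eq_orderHeight M
  calc ((Fintype.card σ + Fintype.card τ : ℕ) : WithBot ℕ∞)
      ≤ ((Order.height M + s.card : ℕ∞) : WithBot ℕ∞) := by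
        rw [← hM]; exact_mod_cast hheight
    _ ≤ ((Order.height M + (T.card + 2 : ℕ) : ℕ∞) : WithBot ℕ∞) := by
        exact WithBot.coe_le_coe.2 (by gcongr)
    _ = (Order.height M : WithBot ℕ∞) + ((T.card + 2 : ℕ) : WithBot ℕ∞) := by
        push_cast; rfl
    _ ≤ _ := by gcongr

end Dimension

/-! ### The Jacobian and curves of critical pairs -/

section Jacobian

variable {k : Type*} [Field k] {n d : ℕ}

/-- The monomial `x^α`. -/
def mono (k : Type*) [Field k] (α : MultiIndex n d) : MvPolynomial (Fin (n + 1)) k :=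
  ∏ l, X l ^ α.1 l

theorem mono_eq_monomial (α : MultiIndex n d) :
    mono k α = monomial (Finsupp.equivFunOnFinite.symm α.1) 1 := by
  rw [mono, monomial_eq, Finsupp.prod_fintype _ _ (by simp)]
  simp

theorem eval_form (c : CoeffIndex n d → k) (i : Fin (n + 1)) (x : Fin (n + 1) → k) :
    eval x (form c i) = ∑ α, c (i, α) * ∏ l, x l ^ α.1 l := by
  simp [form]

section Algebra

variable {K : Type*} [CommRing K] [Algebra k K]

/-- The truncated exponent matters only when `α.1 j = 0`, where the leading factor is zero. -/
theorem aeval_pderiv_mono (x : Fin (n + 1) → K) (α : MultiIndex n d) (j : Fin (n + 1)) :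
    aeval x (pderiv j (mono k α)) = (α.1 j : K) * ∏ l, x l ^ (α.1 l - (Pi.single j 1 : Fin (n + 1) → ℕ) l) := by
  rw [mono_eq_monomial, pderiv_monomial, aeval_monomial, Finsupp.prod_fintype _ _ (by simp)]
  simp [Finsupp.single_eq_pi_single]

/-- The derivative of the monomial `x^α` at `x` along `u`. -/
def dirDeriv (k : Type*) [Field k] [Algebra k K] (x u : Fin (n + 1) → K) (α : MultiIndex n d) : K :=
  ∑ j, aeval x (pderiv j (mono k α)) * u j

/-- The Jacobian matrix at `x` of the tuple of forms with coefficients `c`. -/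
def jacMatrix (k : Type*) [Field k] [Algebra k K] (c : CoeffIndex n d → K) (x : Fin (n + 1) → K) :
    Matrix (Fin (n + 1)) (Fin (n + 1)) K :=
  Matrix.of fun i j => ∑ α, c (i, α) * aeval x (pderiv j (mono k α))

theorem jacMatrix_mulVec (c : CoeffIndex n d → K) (x u : Fin (n + 1) → K) (i : Fin (n + 1)) :
    (jacMatrix k c x).mulVec u i = ∑ α, c (i, α) * dirDeriv k x u α := by
  simp only [Matrix.mulVec, dotProduct, jacMatrix, Matrix.of_apply, dirDeriv, Finset.sum_mul,
    Finset.mul_sum, mul_assoc]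
  exact Finset.sum_comm

theorem aeval_jacobian (c : CoeffIndex n d → K) (x : Fin (n + 1) → K) :
    aeval (Sum.elim c x) (jacobian k n d) = (jacMatrix k c x).det := by
  rw [jacobian, AlgHom.map_det]
  congr 1
  ext i j
  have h : ∀ α : MultiIndex n d,
      (∏ l : Fin (n + 1), X (Sum.inr l) ^ α.1 l : MvPolynomial (CoeffIndex n d ⊕ Fin (n + 1)) k) =
        rename Sum.inr (mono k α) := by
    intro α
    simp [mono]
  simp only [AlgHom.mapMatrix_apply, Matrix.map_apply, Matrix.of_apply, genericForm, jacMatrix,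
    map_sum, Derivation.leibniz, h, pderiv_rename Sum.inr_injective,
    pderiv_X_of_ne Sum.inl_ne_inr, smul_eq_mul, map_mul, aeval_X, Sum.elim_inl,
    aeval_rename, Sum.elim_comp_inr, mul_zero, add_zero]

theorem map_dirDeriv {K' : Type*} [CommRing K'] [Algebra k K'] (φ : K →ₐ[k] K')
    (x u : Fin (n + 1) → K) (α : MultiIndex n d) :
    φ (dirDeriv k x u α) = dirDeriv k (φ ∘ x) (φ ∘ u) α := by
  simp only [dirDeriv, map_sum, map_mul, comp_aeval_apply]
  rfl

end Algebra

theorem eval_jacobian (c : CoeffIndex n d → k) (x : Fin (n + 1) → k) :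
    eval (Sum.elim c x) (jacobian k n d) = (jacMatrix k c x).det := by
  rw [← aeval_jacobian, aeval_eq_eval]

theorem isBihomogeneous_jacobian :
    IsBihomogeneous (jacobian k n d) (n + 1) ((n + 1) * (d - 1)) := by
  have hform : ∀ i, IsBihomogeneous (genericForm k n d i) 1 d := by
    intro i
    refine IsWeightedHomogeneous.sum _ _ _ fun α _ => ?_
    have h₁ := isWeightedHomogeneous_X k (biWeight (CoeffIndex n d) (Fin (n + 1)))
      (Sum.inl (i, α))
    have h₂ := IsWeightedHomogeneous.prod Finset.univ (w := biWeight (CoeffIndex n d) (Fin (n + 1)))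
      (fun l => X (R := k) (Sum.inr l) ^ α.1 l) (fun l => α.1 l • ((0, 1) : ℕ × ℕ))
      fun l _ => (isWeightedHomogeneous_X k _ (Sum.inr l)).pow _
    rw [← Finset.sum_smul, α.2] at h₂
    convert h₁.mul h₂ using 1
    simp
  -- For `d = 0` the exponent `d - 1` is truncated, but all the forms are constant in the `x_j` and
  -- the Jacobian is zero.
  rcases Nat.eq_zero_or_pos d with rfl | hd
  · have h0 : ∀ i j, pderiv (Sum.inr j) (genericForm k n 0 i) = 0 := by
      intro i j
      rw [genericForm, map_sum]
      refine Finset.sum_eq_zero fun α _ => ?_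
      have hα : ∀ l, α.1 l = 0 := fun l => by
        have := α.2
        rw [Finset.sum_eq_zero_iff] at this
        exact this l (Finset.mem_univ l)
      simp [hα]
    have : jacobian k n 0 = 0 := by
      rw [jacobian]
      exact Matrix.det_eq_zero_of_row_eq_zero 0 fun j => h0 0 j
    rw [this]
    exact isWeightedHomogeneous_zero _ _ _
  have hentry : ∀ i j, IsBihomogeneous (pderiv (Sum.inr j) (genericForm k n d i)) 1 (d - 1) := by
    intro i j
    refine IsWeightedHomogeneous.pderiv (hform i) ?_
    simp [Nat.sub_add_cancel hd]
  rw [jacobian, Matrix.det_apply]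
  refine IsWeightedHomogeneous.sum _ _ _ fun g _ => ?_
  have h := IsWeightedHomogeneous.prod Finset.univ (w := biWeight (CoeffIndex n d) (Fin (n + 1)))
    (fun i => pderiv (Sum.inr i) (genericForm k n d (g i))) (fun _ => (1, d - 1))
    fun i _ => hentry (g i) i
  have h' : IsBihomogeneous (∏ i, pderiv (Sum.inr i) (genericForm k n d (g i)))
      (n + 1) ((n + 1) * (d - 1)) := by
    have hsum : ∑ _i : Fin (n + 1), ((1, d - 1) : ℕ × ℕ) = (n + 1, (n + 1) * (d - 1)) := by simp
    rwa [hsum] at h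
  rcases Int.units_eq_one_or (Equiv.Perm.sign g) with hs | hs <;> rw [hs]
  · rw [one_smul]; exact h'
  · rw [Units.neg_smul, one_smul]; exact h'.neg

/-- The exponent of `x_i ^ d`. -/
def powIndex (n d : ℕ) (i : Fin (n + 1)) : MultiIndex n d := ⟨Pi.single i d, by simp⟩

/-- The coefficients of the power map `(x_0 ^ d : … : x_n ^ d)`. -/
def powCoeff (k : Type*) [Field k] (n d : ℕ) : CoeffIndex n d → k :=
  fun q => if q.2 = powIndex n d q.1 then 1 else 0

theorem jacMatrix_powCoeff (x : Fin (n + 1) → k) :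
    jacMatrix k (powCoeff k n d) x = Matrix.diagonal fun i => (d : k) * x i ^ (d - 1) := by
  ext i j
  simp only [jacMatrix, Matrix.of_apply, powCoeff, ite_mul, one_mul, zero_mul,
    Finset.sum_ite_eq', Finset.mem_univ, if_true, aeval_pderiv_mono]
  rcases eq_or_ne i j with rfl | hij
  · rw [Matrix.diagonal_apply_eq, Finset.prod_eq_single i]
    · simp [powIndex]
    · intro l _ hl
      simp [powIndex, hl]
    · simp
  · simp [powIndex, Matrix.diagonal_apply_ne _ hij, hij.symm]

/-- Take `x j ≠ 0`. If `u j ≠ 0`, use `x_j ^ d`, whose derivative has the factor `d`, nonzero in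
characteristic zero. Otherwise use `x_j ^ (d - 1) * x_l` with `u l ≠ 0`; the `j`-term is killed by
`u j = 0`. -/
theorem exists_dirDeriv_ne_zero [CharZero k] (hd : 1 ≤ d) {x u : Fin (n + 1) → k} (hx : x ≠ 0)
    (hu : u ≠ 0) : ∃ α : MultiIndex n d, dirDeriv k x u α ≠ 0 := by
  obtain ⟨j, hj⟩ := Function.ne_iff.1 hx
  obtain ⟨l, hl, hlj⟩ : ∃ l, u l ≠ 0 ∧ (l ≠ j → u j = 0) := by
    by_cases h : u j = 0
    · obtain ⟨l, hl⟩ := Function.ne_iff.1 hu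
      exact ⟨l, hl, fun _ => h⟩
    · exact ⟨j, h, fun h' => absurd rfl h'⟩
  refine ⟨⟨Pi.single j (d - 1) + Pi.single l 1, ?_⟩, ?_⟩
  · simp [Finset.sum_add_distrib, Nat.sub_add_cancel hd]
  · rw [dirDeriv, Finset.sum_eq_single l]
    · rw [aeval_pderiv_mono, Finset.prod_eq_single j]
      · refine mul_ne_zero (mul_ne_zero ?_ ?_) hl
        · simp only [Pi.add_apply, Pi.single_eq_same, ne_eq, Nat.cast_eq_zero]
          omega
        · exact pow_ne_zero _ hj
      · intro m _ hm
        simp [hm]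
      · simp
    · intro m _ hm
      by_cases hmj : m = j
      · subst hmj
        rw [hlj hm.symm, mul_zero]
      · rw [aeval_pderiv_mono]
        simp [hm, hmj]
    · simp

/-- The segment from `a` to `b`. -/
def segment {ι : Type*} (a b : ι → k) (i : ι) : Polynomial k :=
  (1 - Polynomial.X) * Polynomial.C (a i) + Polynomial.X * Polynomial.C (b i)

theorem eval_segment_zero {ι : Type*} (a b : ι → k) :
    Polynomial.aeval (0 : k) ∘ segment a b = a := by
  ext i; simp [segment]

theorem eval_segment_one {ι : Type*} (a b : ι → k) :
    Polynomial.aeval (1 : k) ∘ segment a b = b := by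
  ext i; simp [segment]

/-- Besides a kernel vector `u`, this supplies a form `h` with derivative `1` along `u`, by
multiples of which the components of a tuple can be corrected. -/
theorem exists_kernel_data [CharZero k] (hd : 1 ≤ d) {c : CoeffIndex n d → k}
    {x : Fin (n + 1) → k} (hx : x ≠ 0) (hJ : (jacMatrix k c x).det = 0) :
    ∃ (u : Fin (n + 1) → k) (h : MultiIndex n d → k), u ≠ 0 ∧
      (∀ i, ∑ α, c (i, α) * dirDeriv k x u α = 0) ∧ ∑ α, h α * dirDeriv k x u α = 1 := by
  classical
  obtain ⟨u, hu, hker⟩ := Matrix.exists_mulVec_eq_zero_iff.2 hJ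
  obtain ⟨α, hα⟩ := exists_dirDeriv_ne_zero hd hx hu
  refine ⟨u, Pi.single α (dirDeriv k x u α)⁻¹, hu, fun i => ?_, ?_⟩
  · rw [← jacMatrix_mulVec, hker, Pi.zero_apply]
  · simp [Pi.single_apply, hα]

/-- Two pairs (tuple of forms, critical point) lie on a polynomial curve of such pairs. -/
theorem exists_curve [CharZero k] (hd : 1 ≤ d) {c₀ c₁ : CoeffIndex n d → k}
    {x₀ x₁ : Fin (n + 1) → k} (hx₀ : x₀ ≠ 0) (hx₁ : x₁ ≠ 0)
    (hJ₀ : (jacMatrix k c₀ x₀).det = 0) (hJ₁ : (jacMatrix k c₁ x₁).det = 0) :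
    ∃ (c : CoeffIndex n d → Polynomial k) (x : Fin (n + 1) → Polynomial k),
      (jacMatrix k c x).det = 0 ∧ Polynomial.aeval (0 : k) ∘ c = c₀ ∧
      Polynomial.aeval (0 : k) ∘ x = x₀ ∧ Polynomial.aeval (1 : k) ∘ c = c₁ ∧
      Polynomial.aeval (1 : k) ∘ x = x₁ := by
  obtain ⟨u₀, h₀, hu₀, hc₀, hh₀⟩ := exists_kernel_data hd hx₀ hJ₀
  obtain ⟨u₁, h₁, hu₁, hc₁, hh₁⟩ := exists_kernel_data hd hx₁ hJ₁
  -- Along the segments, `G i` is the error in the kernel equation of the `i`-th form and `H` the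
  -- derivative of the correcting form. Then `H * c - G * h` has error `H * G - G * H = 0`. At both
  -- ends `H = 1` and `G = 0`, so the endpoints are unchanged.
  let D : MultiIndex n d → Polynomial k := dirDeriv k (segment x₀ x₁) (segment u₀ u₁)
  let H := ∑ α, segment h₀ h₁ α * D α
  let G : Fin (n + 1) → Polynomial k := fun i => ∑ α, segment c₀ c₁ (i, α) * D α
  let c : CoeffIndex n d → Polynomial k :=
    fun q => H * segment c₀ c₁ q - G q.1 * segment h₀ h₁ q.2
  have hD₀ : ∀ α, Polynomial.aeval (0 : k) (D α) = dirDeriv k x₀ u₀ α := fun α => by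
    rw [map_dirDeriv, eval_segment_zero, eval_segment_zero]
  have hD₁ : ∀ α, Polynomial.aeval (1 : k) (D α) = dirDeriv k x₁ u₁ α := fun α => by
    rw [map_dirDeriv, eval_segment_one, eval_segment_one]
  have e₀ : ∀ {ι : Type} (a b : ι → k) i, Polynomial.aeval (0 : k) (segment a b i) = a i :=
    fun a b i => congrFun (eval_segment_zero a b) i
  have e₁ : ∀ {ι : Type} (a b : ι → k) i, Polynomial.aeval (1 : k) (segment a b i) = b i :=
    fun a b i => congrFun (eval_segment_one a b) i
  refine ⟨c, segment x₀ x₁, ?_, ?_, eval_segment_zero _ _, ?_, eval_segment_one _ _⟩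
  · refine Matrix.exists_mulVec_eq_zero_iff.1 ⟨segment u₀ u₁, fun h => hu₀ ?_, ?_⟩
    · rw [← eval_segment_zero u₀ u₁, h]
      ext; simp
    · ext1 i
      rw [jacMatrix_mulVec, Pi.zero_apply]
      change ∑ α, (H * segment c₀ c₁ (i, α) - G i * segment h₀ h₁ α) * D α = 0
      simp only [sub_mul, mul_assoc, Finset.sum_sub_distrib, ← Finset.mul_sum]
      change H * G i - G i * H = 0
      ring
  · ext q
    simp only [Function.comp_apply, c, H, G, map_sub, map_mul, map_sum, hD₀, e₀, hc₀, hh₀]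
    ring
  · ext q
    simp only [Function.comp_apply, c, H, G, map_sub, map_mul, map_sum, hD₁, e₁, hc₁, hh₁]
    ring

/-- Irreducibility of the critical locus, in the form: nonvanishing conditions that can be met
separately can be met together. -/
theorem exists_mem_critical_of_ne_zero [CharZero k] (hd : 1 ≤ d) {c₀ c₁ : CoeffIndex n d → k}
    {x₀ x₁ : Fin (n + 1) → k} (hx₀ : x₀ ≠ 0) (hx₁ : x₁ ≠ 0)
    (hJ₀ : (jacMatrix k c₀ x₀).det = 0) (hJ₁ : (jacMatrix k c₁ x₁).det = 0)
    {P Q : MvPolynomial (CoeffIndex n d ⊕ Fin (n + 1)) k}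
    (hP : eval (Sum.elim c₀ x₀) P ≠ 0) (hQ : eval (Sum.elim c₁ x₁) Q ≠ 0) :
    ∃ (c : CoeffIndex n d → k) (x : Fin (n + 1) → k), x ≠ 0 ∧ (jacMatrix k c x).det = 0 ∧
      eval (Sum.elim c x) P ≠ 0 ∧ eval (Sum.elim c x) Q ≠ 0 := by
  obtain ⟨c, x, hJ, hc0, hx0, hc1, hx1⟩ := exists_curve hd hx₀ hx₁ hJ₀ hJ₁
  obtain ⟨j, hj⟩ := Function.ne_iff.1 hx₀
  have comp : ∀ (t : k) (F : MvPolynomial (CoeffIndex n d ⊕ Fin (n + 1)) k),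
      Polynomial.aeval t (aeval (Sum.elim c x) F) =
        eval (Sum.elim (Polynomial.aeval t ∘ c) (Polynomial.aeval t ∘ x)) F := by
    intro t F
    rw [comp_aeval_apply, ← aeval_eq_eval, ← Sum.comp_elim]
    rfl
  have hP' : aeval (Sum.elim c x) P ≠ 0 := fun h => hP (by
    rw [← hc0, ← hx0, ← comp, h, map_zero])
  have hQ' : aeval (Sum.elim c x) Q ≠ 0 := fun h => hQ (by
    rw [← hc1, ← hx1, ← comp, h, map_zero])
  have hj' : x j ≠ 0 := fun h => hj (by
    rw [← hx0, Function.comp_apply, h, map_zero, Pi.zero_apply])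
  -- The factor `x j` keeps the chosen point of the curve away from `x = 0`.
  have hne : aeval (Sum.elim c x) P * aeval (Sum.elim c x) Q * x j ≠ 0 :=
    mul_ne_zero (mul_ne_zero hP' hQ') hj'
  obtain ⟨t, ht⟩ : ∃ t : k, Polynomial.eval t
      (aeval (Sum.elim c x) P * aeval (Sum.elim c x) Q * x j) ≠ 0 := by
    by_contra! h
    exact hne (Polynomial.funext fun t => by rw [h t, Polynomial.eval_zero])
  rw [← Polynomial.coe_aeval_eq_eval] at ht
  simp only [map_mul, mul_ne_zero_iff, comp] at ht
  refine ⟨_, _, fun h => ht.2 (congrFun h j), ?_, ht.1.1, ht.1.2⟩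
  rw [← eval_jacobian, ← comp, aeval_jacobian, hJ, map_zero]

end Jacobian

/-! ### A Macaulay determinant certifying that forms have no common zero -/

section Macaulay

variable {k : Type*} [Field k] {n d : ℕ}

theorem exists_le_apply (β : MultiIndex n ((n + 1) * d)) : ∃ i, d ≤ β.1 i := by
  by_contra! h
  have := Finset.sum_lt_sum_of_nonempty (s := Finset.univ) Finset.univ_nonempty fun i _ => h i
  rw [β.2] at this
  simp at this

/-- A variable whose `d`-th power divides the monomial `x^β` of degree `(n + 1) d`. -/
def divIndex (β : MultiIndex n ((n + 1) * d)) : Fin (n + 1) := (exists_le_apply β).choose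

theorem single_divIndex_le (β : MultiIndex n ((n + 1) * d)) : Pi.single (divIndex β) d ≤ β.1 := by
  intro l
  rcases eq_or_ne l (divIndex β) with rfl | hl
  · rw [Pi.single_eq_same]
    exact (exists_le_apply β).choose_spec
  · simp [hl]

/-- The coefficients of the forms `(x^β / x_i^d) f_i`, where `x_i^d` divides `x^β`. -/
def macaulay {K : Type*} [CommRing K] (c : CoeffIndex n d → K) :
    Matrix (MultiIndex n ((n + 1) * d)) (MultiIndex n ((n + 1) * d)) K :=
  Matrix.of fun β γ => ∑ α : MultiIndex n d,
    if β.1 - Pi.single (divIndex β) d + α.1 = γ.1 then c (divIndex β, α) else 0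

/-- A row of the matrix lists the coefficients of a monomial multiple of some `f_i`. A common zero
`x` of the forms therefore makes the vector of monomials at `x` a kernel vector. -/
theorem macaulay_mulVec (c : CoeffIndex n d → k) (x : Fin (n + 1) → k)
    (β : MultiIndex n ((n + 1) * d)) :
    (macaulay c).mulVec (fun γ => ∏ l, x l ^ γ.1 l) β =
      (∏ l, x l ^ (β.1 - (Pi.single (divIndex β) d : Fin (n + 1) → ℕ)) l) * eval x (form c (divIndex β)) := by
  simp only [Matrix.mulVec, dotProduct, macaulay, Matrix.of_apply, Finset.sum_mul, eval_form,
    Finset.mul_sum]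
  rw [Finset.sum_comm]
  refine Finset.sum_congr rfl fun α _ => ?_
  have hdeg : ∑ l, (β.1 - (Pi.single (divIndex β) d : Fin (n + 1) → ℕ) + α.1) l = (n + 1) * d := by
    have h := congrArg (fun f => ∑ l, f l) (tsub_add_cancel_of_le (single_divIndex_le β))
    simp only [Pi.add_apply, Finset.sum_add_distrib, β.2, Finset.sum_pi_single', Finset.mem_univ,
      if_true] at h
    simp only [Pi.add_apply, Finset.sum_add_distrib, α.2]
    exact h
  rw [Finset.sum_eq_single ⟨_, hdeg⟩]
  · simp only [if_true, Pi.add_apply, pow_add, Finset.prod_mul_distrib]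
    ring
  · intro γ _ hγ
    rw [if_neg, zero_mul]
    exact fun h => hγ (Subtype.ext h.symm)
  · simp

theorem macaulay_powCoeff : macaulay (powCoeff k n d) = 1 := by
  ext β γ
  simp only [macaulay, Matrix.of_apply, powCoeff]
  rw [Finset.sum_eq_single (powIndex n d (divIndex β))]
  · simp [powIndex, tsub_add_cancel_of_le (single_divIndex_le β), Matrix.one_apply, Subtype.ext_iff]
  · intro α _ hα
    simp [hα]
  · simp

theorem exists_form_ne_zero_of_det_macaulay_ne_zero (hd : 1 ≤ d) {c : CoeffIndex n d → k}
    (hc : (macaulay c).det ≠ 0) (x : Fin (n + 1) → k) (hx : x ≠ 0) :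
    ∃ i, eval x (form c i) ≠ 0 := by
  by_contra! h
  have h0 : (macaulay c).mulVec (fun γ => ∏ l, x l ^ γ.1 l) = 0 := by
    ext β
    rw [macaulay_mulVec, h, mul_zero, Pi.zero_apply]
  have h1 := Matrix.eq_zero_of_mulVec_eq_zero hc h0
  obtain ⟨j, hj⟩ := Function.ne_iff.1 hx
  -- The entry at `x_j ^ ((n + 1) * d)` cannot vanish when `x j ≠ 0`.
  have h2 := congrFun h1 (powIndex n _ j)
  rw [Pi.zero_apply, Finset.prod_eq_zero_iff] at h2
  obtain ⟨l, -, hl⟩ := h2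
  rcases eq_or_ne l j with rfl | hlj
  · exact hj (pow_eq_zero_iff (by simp [powIndex]; omega) |>.1 hl)
  · simp [powIndex, hlj] at hl

/-- The determinant of the Macaulay matrix as a polynomial. -/
def macaulayDet (k : Type*) [Field k] (τ : Type*) (n d : ℕ) : MvPolynomial (CoeffIndex n d ⊕ τ) k :=
  (macaulay fun q => X (Sum.inl q)).det

theorem eval_macaulayDet {τ : Type*} (c : CoeffIndex n d → k) (w : τ → k) :
    eval (Sum.elim c w) (macaulayDet k τ n d) = (macaulay c).det := by
  rw [macaulayDet, RingHom.map_det]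
  congr 1
  ext β γ
  simp [macaulay, apply_ite]

end Macaulay

theorem card_multiIndex (n d : ℕ) : Fintype.card (MultiIndex n d) = (n + d).choose d := by
  rw [Fintype.card_congr (Sym.equivNatSumOfFintype (Fin (n + 1)) d).symm, Sym.card_sym_eq_choose,
    Fintype.card_fin]
  congr 1
  omega

theorem card_coeffIndex (n d : ℕ) :
    Fintype.card (CoeffIndex n d) = (n + 1) * (n + d).choose d := by
  rw [Fintype.card_prod, Fintype.card_fin, card_multiIndex]

theorem le_of_natCast_add_le {a c : ℕ} {x : WithBot ℕ∞}
    (h : ((a + c : ℕ) : WithBot ℕ∞) ≤ x + (c : WithBot ℕ∞)) : (a : WithBot ℕ∞) ≤ x := by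
  induction x using WithBot.recBotCoe with
  | bot => simp at h
  | coe x =>
    induction x using ENat.recTopCoe with
    | top => exact le_top
    | coe m =>
      have h' : a + c ≤ m + c := by exact_mod_cast h
      have : a ≤ m := by omega
      exact_mod_cast this

/-! ### A single projective space as a slice of a product -/

section ProjEmbedding

variable {k : Type*} [Field k] {σ τ : Type*}

theorem IsBihomogeneous.specialize {F : MvPolynomial (σ ⊕ τ) k} {a b : ℕ}
    (hF : IsBihomogeneous F a b) (w : τ → k) :
    (aeval (Sum.elim X fun j => C (w j)) F : MvPolynomial σ k).IsHomogeneous a := by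
  rw [F.as_sum, map_sum]
  refine IsHomogeneous.sum _ _ _ fun m hm => ?_
  rw [aeval_monomial, algebraMap_eq, Finsupp.prod]
  have hdeg := congrArg Prod.fst (hF (mem_support_iff.1 hm))
  rw [Finsupp.weight_apply, Finsupp.sum, Prod.fst_sum] at hdeg
  have h : ∀ i n, IsHomogeneous ((Sum.elim X fun j => C (w j) : σ ⊕ τ → MvPolynomial σ k) i ^ n)
      (n • biWeight σ τ i).1 := by
    rintro (i | i) n
    · simpa using (isHomogeneous_X k i).pow n
    · simpa using (isHomogeneous_C σ (w i)).pow n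
  have h' := IsHomogeneous.prod m.support _ (fun i => (m i • biWeight σ τ i).1)
    fun i _ => h i (m i)
  rw [hdeg] at h'
  simpa using (isHomogeneous_C σ _).mul h'

/-- Fixing the second point turns bidegree `(a, b)` into degree `a`, and a form of degree `a` is
bihomogeneous of bidegree `(a, 0)`. With a one-point second factor, the bounds for products apply to
`EndSpace`. -/
theorem Proj.isInducing_prodMk (q : Proj k τ) :
    IsInducing fun p : Proj k σ => (⟨p, q⟩ : BiProj k σ τ) := by
  classical
  refine ⟨?_⟩
  change generateFrom _ = induced _ (generateFrom _)
  rw [induced_generateFrom_eq]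
  congr 1
  ext U
  constructor
  · rintro ⟨F, a, hF, rfl⟩
    refine ⟨_, ⟨rename Sum.inl F, a, 0, ?_, rfl⟩, ?_⟩
    · rw [F.as_sum, map_sum]
      refine IsWeightedHomogeneous.sum _ _ _ fun m hm => ?_
      rw [rename_monomial]
      refine isWeightedHomogeneous_monomial _ _ _ ?_
      have hdeg := hF (mem_support_iff.1 hm)
      rw [Finsupp.weight_apply, Finsupp.sum] at hdeg ⊢
      rw [Finsupp.mapDomain_support_of_injective Sum.inl_injective]
      rw [Finset.sum_image Sum.inl_injective.injOn]
      simp only [Finsupp.mapDomain_apply Sum.inl_injective, Sum.elim_inl, Prod.smul_mk,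
        smul_zero]
      rw [Prod.ext_iff, Prod.fst_sum, Prod.snd_sum]
      exact ⟨hdeg, by simp⟩
    · ext p
      simp [BiProj.zeros, Proj.zeros, eval_rename]
  · rintro ⟨_, ⟨F, a, b, hF, rfl⟩, rfl⟩
    refine ⟨_, a, hF.specialize q.coord, ?_⟩
    ext p
    simp only [BiProj.zeros, Proj.zeros, Set.mem_preimage, Set.mem_compl_iff, Set.mem_ofPred_eq]
    rw [← aeval_eq_eval, ← aeval_eq_eval, comp_aeval_apply]
    have : (Sum.elim p.coord q.coord : σ ⊕ τ → k) =
        fun i => aeval p.coord (Sum.elim X (fun j => C (q.coord j)) i) := by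
      ext (i | i) <;> simp
    rw [this]

theorem coneHom_ne_zero_of_eq_ofVec {z : BiProj k σ τ} {v : σ → k} {hv : v ≠ 0} {w : τ → k}
    {hw : w ≠ 0} (hz : z = BiProj.ofVec v hv w hw) {P : MvPolynomial (σ ⊕ τ) k}
    (hP : eval (Sum.elim v w) P ≠ 0) : coneHom z.fst.coord z.snd.coord P ≠ 0 := by
  subst hz
  obtain ⟨s, hs⟩ := Projectivization.exists_smul_eq_mk_rep k v hv
  obtain ⟨t, ht⟩ := Projectivization.exists_smul_eq_mk_rep k w hw
  refine coneHom_ne_zero_of_eval_ne_zero ((s⁻¹ : kˣ) : k) ((t⁻¹ : kˣ) : k) ?_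
  have h1 : ((s⁻¹ : kˣ) : k) • (Projectivization.mk k v hv).rep = v := by
    rw [← hs, ← Units.smul_def, inv_smul_smul]
  have h2 : ((t⁻¹ : kˣ) : k) • (Projectivization.mk k w hw).rep = w := by
    rw [← ht, ← Units.smul_def, inv_smul_smul]
  simpa only [Proj.coord, h1, h2] using hP

end ProjEmbedding

/-! ### The critical locus: irreducibility, codimension and dimension -/

section Endomorphisms

variable {k : Type*} [Field k] {n d : ℕ}

theorem ne_zero_of_det_macaulay_ne_zero (hd : 1 ≤ d) {c : CoeffIndex n d → k}
    (hc : (macaulay c).det ≠ 0) : c ≠ 0 := by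
  rintro rfl
  obtain ⟨i, hi⟩ := exists_form_ne_zero_of_det_macaulay_ne_zero hd hc (fun _ => 1)
    (fun h => one_ne_zero (congrFun h 0))
  simp [form] at hi

theorem isMorphism_mk (hd : 1 ≤ d) {c : CoeffIndex n d → k} (hc : (macaulay c).det ≠ 0)
    (hc0 : c ≠ 0) : IsMorphism (⟨Projectivization.mk k c hc0⟩ : Proj k (CoeffIndex n d)) :=
  (isMorphism_mk_iff c hc0).2 (exists_form_ne_zero_of_det_macaulay_ne_zero hd hc)

theorem exists_endTimesProj (hd : 1 ≤ d) {c : CoeffIndex n d → k} (hc : (macaulay c).det ≠ 0)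
    {x : Fin (n + 1) → k} (hx : x ≠ 0) :
    ∃ (hc0 : c ≠ 0) (z : EndTimesProj k n d), z.1 = BiProj.ofVec c hc0 x hx :=
  ⟨ne_zero_of_det_macaulay_ne_zero hd hc,
    ⟨BiProj.ofVec c (ne_zero_of_det_macaulay_ne_zero hd hc) x hx, isMorphism_mk hd hc _⟩, rfl⟩

theorem mem_criticalLocus_of_eq_ofVec {z : EndTimesProj k n d} {c : CoeffIndex n d → k}
    {hc : c ≠ 0} {x : Fin (n + 1) → k} {hx : x ≠ 0} (hz : z.1 = BiProj.ofVec c hc x hx) :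
    z ∈ criticalLocus k n d ↔ (jacMatrix k c x).det = 0 := by
  change z.1 ∈ BiProj.zeros _ ↔ _
  rw [hz, BiProj.ofVec, BiProj.mem_zeros_iff isBihomogeneous_jacobian, eval_jacobian]

theorem det_jacMatrix_of_mem_criticalLocus {z : EndTimesProj k n d}
    (hz : z ∈ criticalLocus k n d) : (jacMatrix k z.1.fst.coord z.1.snd.coord).det = 0 := by
  rw [← eval_jacobian]
  exact hz

theorem isClosed_criticalLocus : IsClosed (criticalLocus k n d) :=
  (isOpen_compl_iff.1 (BiProj.isOpen_compl_zeros isBihomogeneous_jacobian)).preimage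
    continuous_subtype_val

/-- Basic open sets suffice, and the witness may be given in any homogeneous coordinates because
bihomogeneous vanishing does not depend on them. -/
theorem isIrreducible_of_basic {S : Set (EndTimesProj k n d)} (hne : S.Nonempty)
    (h : ∀ F G : MvPolynomial (CoeffIndex n d ⊕ Fin (n + 1)) k,
      (∃ z ∈ S, eval (Sum.elim z.1.fst.coord z.1.snd.coord) F ≠ 0) →
      (∃ z ∈ S, eval (Sum.elim z.1.fst.coord z.1.snd.coord) G ≠ 0) →
      ∃ (c : CoeffIndex n d → k) (hc : c ≠ 0) (x : Fin (n + 1) → k) (hx : x ≠ 0), ∃ z ∈ S,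
        z.1 = BiProj.ofVec c hc x hx ∧ eval (Sum.elim c x) F ≠ 0 ∧ eval (Sum.elim c x) G ≠ 0) :
    IsIrreducible S := by
  refine ⟨hne, ?_⟩
  rintro _ _ ⟨U, hU, rfl⟩ ⟨V, hV, rfl⟩ ⟨z, hzS, hzU⟩ ⟨y, hyS, hyV⟩
  obtain ⟨F, a, b, hF, hzF, hFU⟩ := BiProj.exists_basic_subset hU hzU
  obtain ⟨G, a', b', hG, hyG, hGV⟩ := BiProj.exists_basic_subset hV hyV
  obtain ⟨c, hc, x, hx, w, hwS, hw, hFw, hGw⟩ := h F G ⟨z, hzS, hzF⟩ ⟨y, hyS, hyG⟩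
  refine ⟨w, hwS, hFU ?_, hGV ?_⟩
  · rwa [hw, Set.mem_compl_iff, BiProj.ofVec, BiProj.mem_zeros_iff hF]
  · rwa [hw, Set.mem_compl_iff, BiProj.ofVec, BiProj.mem_zeros_iff hG]

theorem det_macaulay_powCoeff : (macaulay (powCoeff k n d)).det ≠ 0 := by
  rw [macaulay_powCoeff, Matrix.det_one]
  exact one_ne_zero

theorem single_zero_ne_zero : (Pi.single 0 1 : Fin (n + 1) → k) ≠ 0 :=
  fun h => one_ne_zero (α := k) (by simpa using congrFun h 0)

theorem det_jacMatrix_powCoeff_single (hn : 1 ≤ n) (hd : 2 ≤ d) :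
    (jacMatrix k (powCoeff k n d) (Pi.single 0 1)).det = 0 := by
  rw [jacMatrix_powCoeff, Matrix.det_diagonal]
  refine Finset.prod_eq_zero (Finset.mem_univ (Fin.last n)) ?_
  have : Fin.last n ≠ 0 := by
    rw [Ne, Fin.ext_iff, Fin.val_last, Fin.val_zero]
    omega
  rw [Pi.single_eq_of_ne this, zero_pow (by omega), mul_zero]

theorem det_jacMatrix_powCoeff_one [CharZero k] (hd : 2 ≤ d) :
    (jacMatrix k (powCoeff k n d) fun _ => 1).det ≠ 0 := by
  rw [jacMatrix_powCoeff, Matrix.det_diagonal, Finset.prod_ne_zero_iff]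
  intro i _
  simp
  omega

theorem jacobian_ne_zero [CharZero k] (hd : 2 ≤ d) : jacobian k n d ≠ 0 := by
  intro h
  apply det_jacMatrix_powCoeff_one (k := k) (n := n) hd
  rw [← eval_jacobian, h, map_zero]

theorem exists_critical_powCoeff (hn : 1 ≤ n) (hd : 2 ≤ d) :
    ∃ (hc : powCoeff k n d ≠ 0), ∃ z ∈ criticalLocus k n d,
      z.1 = BiProj.ofVec (powCoeff k n d) hc (Pi.single 0 1) single_zero_ne_zero := by
  obtain ⟨hc, z, hz⟩ := exists_endTimesProj (by omega) (det_macaulay_powCoeff (k := k) (n := n)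
    (d := d)) single_zero_ne_zero
  exact ⟨hc, z, (mem_criticalLocus_of_eq_ofVec hz).2 (det_jacMatrix_powCoeff_single hn hd), hz⟩

theorem isIrreducible_criticalLocus [CharZero k] (hn : 1 ≤ n) (hd : 2 ≤ d) :
    IsIrreducible (criticalLocus k n d) := by
  obtain ⟨-, z, hz, -⟩ := exists_critical_powCoeff (k := k) hn hd
  refine isIrreducible_of_basic ⟨z, hz⟩ ?_
  rintro F G ⟨z₀, hz₀, hF⟩ ⟨z₁, hz₁, hG⟩
  have hR : eval (Sum.elim (powCoeff k n d) (Pi.single 0 1 : Fin (n + 1) → k))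
      (macaulayDet k (Fin (n + 1)) n d) ≠ 0 := by
    rw [eval_macaulayDet]
    exact det_macaulay_powCoeff
  -- Two curves are used: the first, towards the power map, makes `F` and the Macaulay determinant
  -- nonzero together; the second adds `G`.
  obtain ⟨c, x, hx, hJ, hcF, hcR⟩ := exists_mem_critical_of_ne_zero (by omega)
    z₀.1.snd.coord_ne_zero single_zero_ne_zero (det_jacMatrix_of_mem_criticalLocus hz₀)
    (det_jacMatrix_powCoeff_single hn hd) hF hR
  obtain ⟨c', x', hx', hJ', hFR, hG'⟩ := exists_mem_critical_of_ne_zero (by omega)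
    hx z₁.1.snd.coord_ne_zero hJ (det_jacMatrix_of_mem_criticalLocus hz₁)
    (P := F * macaulayDet k (Fin (n + 1)) n d) (by rw [map_mul]; exact mul_ne_zero hcF hcR) hG
  rw [map_mul, mul_ne_zero_iff, eval_macaulayDet] at hFR
  obtain ⟨hc0, y, hy⟩ := exists_endTimesProj (by omega) hFR.2 hx'
  exact ⟨c', hc0, x', hx', y, (mem_criticalLocus_of_eq_ofVec hy).2 hJ', hy, hFR.1, hG'⟩

theorem isIrreducible_univ_endTimesProj [CharZero k] (hd : 2 ≤ d) :
    IsIrreducible (Set.univ : Set (EndTimesProj k n d)) := by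
  obtain ⟨-, z, -⟩ := exists_endTimesProj (by omega) (det_macaulay_powCoeff (k := k) (n := n)
    (d := d)) single_zero_ne_zero
  refine isIrreducible_of_basic ⟨z, Set.mem_univ z⟩ ?_
  rintro F G ⟨z₀, -, hF⟩ ⟨z₁, -, hG⟩
  have hF0 : F ≠ 0 := by rintro rfl; simp at hF
  have hG0 : G ≠ 0 := by rintro rfl; simp at hG
  have hR0 : macaulayDet k (Fin (n + 1)) n d ≠ 0 := fun h =>
    det_macaulay_powCoeff (k := k) (n := n) (d := d) (by
      rw [← eval_macaulayDet (powCoeff k n d) (0 : Fin (n + 1) → k), h, map_zero])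
  have hne := mul_ne_zero (mul_ne_zero hF0 hG0) (mul_ne_zero hR0
    (X_ne_zero (R := k) (Sum.inr 0 : CoeffIndex n d ⊕ Fin (n + 1))))
  obtain ⟨q, hq⟩ : ∃ q, eval q (F * G * (macaulayDet k (Fin (n + 1)) n d * X (Sum.inr 0))) ≠ 0 := by
    by_contra! h
    exact hne (MvPolynomial.funext fun q => by rw [h q, map_zero])
  obtain ⟨c, x, rfl⟩ : ∃ c x, q = Sum.elim c x :=
    ⟨q ∘ Sum.inl, q ∘ Sum.inr, (Sum.elim_comp_inl_inr q).symm⟩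
  simp only [map_mul, mul_ne_zero_iff, eval_macaulayDet, eval_X, Sum.elim_inr] at hq
  have hx : x ≠ 0 := fun h => hq.2.2 (congrFun h 0)
  obtain ⟨hc0, y, hy⟩ := exists_endTimesProj (by omega) hq.2.1 hx
  exact ⟨c, hc0, x, hx, y, Set.mem_univ y, hy, hq.1.1, hq.1.2⟩

/-- Irreducibility of the polynomial `J` is not needed: any minimal prime of `(J)` inside the ideal
of the bi-cone is shown to equal it. -/
theorem coneIdeal_criticalLocus_mem_minimalPrimes [IsAlgClosed k] [CharZero k] (hn : 1 ≤ n)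
    (hd : 2 ≤ d) : coneIdeal (Subtype.val '' criticalLocus k n d) ∈
      (Ideal.span {jacobian k n d}).minimalPrimes := by
  set I := coneIdeal (Subtype.val '' criticalLocus k n d) with hI
  have hIp : I.IsPrime := coneIdeal_isPrime ((isIrreducible_criticalLocus hn hd).image _
    continuous_subtype_val.continuousOn)
  have hJI : Ideal.span {jacobian k n d} ≤ I := by
    rw [Ideal.span_singleton_le_iff_mem, hI, mem_coneIdeal]
    rintro _ ⟨z, hz, rfl⟩
    exact (coneHom_eq_zero_iff isBihomogeneous_jacobian).2 hz
  obtain ⟨p, hp, hpI⟩ := Ideal.exists_minimalPrimes_le hJI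
  obtain ⟨hc, z, hz, hzeq⟩ := exists_critical_powCoeff (k := k) hn hd
  have hnot : ∀ P, eval (Sum.elim (powCoeff k n d) (Pi.single 0 1 : Fin (n + 1) → k)) P ≠ 0 →
      P ∉ I := fun P hP h =>
    coneHom_ne_zero_of_eq_ofVec hzeq hP (mem_coneIdeal.1 h _ ⟨z, hz, rfl⟩)
  have hpp := hp.1.1
  have hIp' : I ≤ p := by
    intro P hP
    -- A zero of `J` where both extra factors are nonzero lies over a point of `V(J)`, so `P`
    -- vanishes there and the product lies in the radical of `(J)`. Neither factor lies in `p ≤ I`,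
    -- since both are nonzero at the power map with marked point `(1 : 0 : … : 0)`.
    have hmem : P * (macaulayDet k (Fin (n + 1)) n d * X (Sum.inr 0)) ∈ p := by
      refine hpp.radical_le_iff.2 hp.1.2 ?_
      rw [← vanishingIdeal_zeroLocus_eq_radical (K := k), mem_vanishingIdeal_iff]
      intro q hq
      obtain ⟨c, x, rfl⟩ : ∃ c x, q = Sum.elim c x :=
        ⟨q ∘ Sum.inl, q ∘ Sum.inr, (Sum.elim_comp_inl_inr q).symm⟩
      have hJ := mem_zeroLocus_iff.1 hq _ (Ideal.mem_span_singleton_self _)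
      rw [aeval_jacobian] at hJ
      simp only [aeval_eq_eval]
      by_contra hne
      simp only [map_mul, mul_eq_zero, not_or, eval_macaulayDet, eval_X, Sum.elim_inr] at hne
      have hx : x ≠ 0 := fun h => hne.2.2 (congrFun h 0)
      obtain ⟨hc0, y, hy⟩ := exists_endTimesProj (by omega) hne.2.1 hx
      exact coneHom_ne_zero_of_eq_ofVec hy hne.1
        (mem_coneIdeal.1 hP _ ⟨y, (mem_criticalLocus_of_eq_ofVec hy).2 hJ, rfl⟩)
    refine (hpp.mem_or_mem hmem).resolve_right fun h => ?_
    rcases hpp.mem_or_mem h with h | h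
    · refine hnot _ ?_ (hpI h)
      rw [eval_macaulayDet]
      exact det_macaulay_powCoeff
    · exact hnot _ (by simp) (hpI h)
  rwa [← le_antisymm hpI hIp']

theorem isHypersurface_criticalLocus [IsAlgClosed k] [CharZero k] (hn : 1 ≤ n) (hd : 2 ≤ d) :
    IsHypersurface (criticalLocus k n d) := by
  refine ⟨isClosed_criticalLocus, fun Z hZ => ?_⟩
  let Z₀ : IrreducibleCloseds (EndTimesProj k n d) :=
    ⟨criticalLocus k n d, isIrreducible_criticalLocus hn hd, isClosed_criticalLocus⟩
  obtain rfl : Z = Z₀ := le_antisymm (show (Z : Set _) ⊆ criticalLocus k n d from hZ.1)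
    (hZ.2 (y := Z₀) subset_rfl (show (Z : Set _) ⊆ criticalLocus k n d from hZ.1))
  refine le_antisymm ?_ (Order.one_le_iff_pos.2 (Order.coheight_pos.2 fun hmax => ?_))
  · let he : IsInducing (Subtype.val : EndTimesProj k n d → _) := IsInducing.subtypeVal
    have h₁ := Order.coheight_le_coheight_apply_of_strictMono
      (fun Z => OrderDual.toDual (conePrime he Z))
      (fun _ _ h => OrderDual.toDual_lt_toDual.2 (conePrime_strictAnti he h)) Z₀
    rw [Order.coheight_toDual, ← PrimeSpectrum.height_eq_orderHeight] at h₁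
    exact h₁.trans (Ideal.height_le_one_of_isPrincipal_of_mem_minimalPrimes _ _
      (coneIdeal_criticalLocus_mem_minimalPrimes hn hd))
  · obtain ⟨hc, z, hz⟩ := exists_endTimesProj (by omega) (det_macaulay_powCoeff (k := k) (n := n)
      (d := d)) (x := fun _ => 1) (fun h => one_ne_zero (congrFun h 0))
    have hle := hmax (b := ⟨Set.univ, isIrreducible_univ_endTimesProj hd, isClosed_univ⟩)
      (Set.subset_univ _)
    exact det_jacMatrix_powCoeff_one hd
      ((mem_criticalLocus_of_eq_ofVec hz).1 (hle (Set.mem_univ z)))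

/-- The only point of `ℙ⁰`. -/
def unitPoint (k : Type*) [Field k] : Proj k Unit :=
  ⟨Projectivization.mk k (fun _ => 1) fun h => one_ne_zero (congrFun h ())⟩

theorem topologicalKrullDim_endSpace [IsAlgClosed k] (hd : 2 ≤ d) :
    topologicalKrullDim (EndSpace k n d) =
      (((n + 1) * (n + d).choose d - 1 : ℕ) : WithBot ℕ∞) := by
  have he : IsInducing fun f : EndSpace k n d =>
      (⟨f.1, unitPoint k⟩ : BiProj k (CoeffIndex n d) Unit) :=
    (Proj.isInducing_prodMk (unitPoint k)).comp IsInducing.subtypeVal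
  have hpos : 0 < (n + 1) * (n + d).choose d :=
    Nat.mul_pos n.succ_pos (Nat.choose_pos (Nat.le_add_left d n))
  refine le_antisymm (iSup_le fun p => ?_) ?_
  · have := length_add_two_le he p
    rw [card_coeffIndex, Fintype.card_unit] at this
    have h' : p.length ≤ (n + 1) * (n + d).choose d - 1 := by omega
    exact_mod_cast h'
  -- The chart is where the coefficient of `x_0 ^ d` in `f_0` is `1`; it contains the power map.
  · have := card_le_topologicalKrullDim_add he ∅ (macaulayDet k Unit n d) (0, powIndex n d 0) ()
      (by
        intro v hv w hw _ hw1 _ hR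
        rw [eval_macaulayDet] at hR
        obtain rfl : w = fun _ => 1 := by ext; exact hw1
        exact ⟨⟨_, isMorphism_mk (by omega) hR hv⟩, rfl⟩)
      (powCoeff k n d) (fun _ => 1) (by simp [powCoeff]) rfl (by simp)
      (by rw [eval_macaulayDet]; exact det_macaulay_powCoeff)
    rw [card_coeffIndex, Fintype.card_unit, Finset.card_empty, zero_add] at this
    refine le_of_natCast_add_le (c := 2) ?_
    convert this using 2
    omega

theorem topologicalKrullDim_criticalLocus [IsAlgClosed k] [CharZero k] (hn : 1 ≤ n) (hd : 2 ≤ d) :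
    topologicalKrullDim (criticalLocus k n d) =
      ((n + ((n + 1) * (n + d).choose d - 1) - 1 : ℕ) : WithBot ℕ∞) := by
  have he : IsInducing fun z : criticalLocus k n d => z.1.1 :=
    IsInducing.subtypeVal.comp IsInducing.subtypeVal
  have hpos : 0 < (n + 1) * (n + d).choose d :=
    Nat.mul_pos n.succ_pos (Nat.choose_pos (Nat.le_add_left d n))
  refine le_antisymm (iSup_le fun p => ?_) ?_
  · have := length_add_three_le he p (jacobian_ne_zero hd) fun z =>
      (coneHom_eq_zero_iff isBihomogeneous_jacobian).2 z.2
    rw [card_coeffIndex, Fintype.card_fin] at this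
    have h' : p.length ≤ n + ((n + 1) * (n + d).choose d - 1) - 1 := by omega
    exact_mod_cast h'
  · have := card_le_topologicalKrullDim_add he {jacobian k n d} (macaulayDet k (Fin (n + 1)) n d)
      (0, powIndex n d 0) 0
      (by
        intro v hv w hw _ _ hJ hR
        rw [eval_macaulayDet] at hR
        have hJ' := hJ _ (Finset.mem_singleton_self _)
        rw [eval_jacobian] at hJ'
        obtain ⟨hc0, y, hy⟩ := exists_endTimesProj (by omega) hR hw
        exact ⟨⟨y, (mem_criticalLocus_of_eq_ofVec hy).2 hJ'⟩, hy⟩)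
      (powCoeff k n d) (Pi.single 0 1) (by simp [powCoeff]) (by simp)
      (by
        intro P hP
        rw [Finset.mem_singleton.1 hP, eval_jacobian]
        exact det_jacMatrix_powCoeff_single hn hd)
      (by rw [eval_macaulayDet]; exact det_macaulay_powCoeff)
    rw [card_coeffIndex, Fintype.card_fin, Finset.card_singleton] at this
    -- Three equations are cut out: two dehomogenizations and `J` itself.
    refine le_of_natCast_add_le (c := 3) ?_
    convert this using 2
    omega

end Endomorphisms

end

end MarkedCrit

theorem mainTheorem8 (k : Type*) [Field k] [IsAlgClosed k] [CharZero k] (n d : ℕ)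
    (hn : 1 ≤ n) (hd : 2 ≤ d) :
    IsIrreducible (MarkedCrit.criticalLocus k n d) ∧
      MarkedCrit.IsHypersurface (MarkedCrit.criticalLocus k n d) ∧
      topologicalKrullDim (MarkedCrit.EndSpace k n d)
        = (((n + 1) * (n + d).choose d - 1 : ℕ) : WithBot ℕ∞) ∧
      topologicalKrullDim (MarkedCrit.criticalLocus k n d)
        = ((n + ((n + 1) * (n + d).choose d - 1) - 1 : ℕ) : WithBot ℕ∞) :=
  ⟨MarkedCrit.isIrreducible_criticalLocus hn hd, MarkedCrit.isHypersurface_criticalLocus hn hd,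
    MarkedCrit.topologicalKrullDim_endSpace hd, MarkedCrit.topologicalKrullDim_criticalLocus hn hd⟩
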